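/- All graphs are finite and may have loops and parallel edges. For a graph $H$ let $v(H)$ and $e(H)$ be its numbers of vertices and edges, and let $\mathrm{mad}(G)=\max\{\,2e(H)/v(H) : H\subseteq G,\ V(H)\neq\varnothing\,\}$ be the maximum average degree of $G$. A pseudoforest is a graph in which each connected component contains at most one cycle (a loop is a cycle of length $1$, two parallel edges form a cycle of length $2$). A decomposition of $G$ into $m$ graphs is a partition of $E(G)$ into $m$ (possibly empty) classes, each regarded as a spanning subgraph of $G$. The diameter $\mathrm{diam}(K)$ of a connected graph $K$ is the largest distance between two of its vertices. **Theorem.** Let $k,d\in\mathbb N=\{0,1,2,\dots\}$ with $k\ge 1$, and let $\ell=\left\lfloor\frac{d-1}{k+1}\right\rfloor$. Then every graph $G$ with $\mathrm{mad}(G)\le 2\left(k+\frac{d}{d+k+1}\right)$ decomposes into $k+1$ pseudoforests, one of which, $F$, is acyclic and is such that every connected component $K$ of $F$ satisfies: - $e(K)\le d$; - $\mathrm{diam}(K)\le 2\ell+2$, and if $d\equiv 1 \pmod{k+1}$, then $\mathrm{diam}(K)\le 2\ell+1$; - for every $z\in\mathbb N$, if $e(K)\ge d-z(k-1)+1$,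 then $\mathrm{diam}(K)\le 2z$. -/

import Mathlib

open scoped Graph

namespace Graph

variable {α β : Type*}

/-- The maximum average degree of a finite multigraph: the maximum of `2 e(H) / v(H)` over all
subgraphs `H` with at least one vertex. For finite `G` the set below is finite, so that its
supremum is a maximum as soon as `G` has a vertex (it is `0` for the graph without vertices). -/
noncomputable def mad (G : Graph α β) : ℝ :=
  sSup {r : ℝ | ∃ H : Graph α β, H ≤ G ∧ V(H).Nonempty ∧
    r = 2 * (E(H).ncard : ℝ) / (V(H).ncard : ℝ)}

/-- The underlying simple graph of a multigraph, on the vertices of the multigraph: loops are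
dropped and parallel edges are identified. It has the same connectivity and the same
distances as the multigraph. -/
def underlying (G : Graph α β) : SimpleGraph V(G) :=
  SimpleGraph.fromRel fun x y : V(G) => G.Adj (x : α) (y : α)

/-- A multigraph is connected if it has a vertex and any two of its vertices are joined
by a walk. -/
def IsConnected (G : Graph α β) : Prop :=
  G.underlying.Connected

/-- `K` is a component of `G`: an inclusion-maximal connected subgraph. -/
def IsComponent (K G : Graph α β) : Prop :=
  Maximal (fun H : Graph α β => H ≤ G ∧ H.IsConnected) K

/-- The diameter: the largest distance between two vertices. It is only used for finite
connected graphs, where the maximum exists. -/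
noncomputable def diameter (G : Graph α β) : ℕ :=
  G.underlying.diam

/-- `C` is a cycle of length `n + 1` for some `n`: its vertices `v 0, …, v n` are distinct, its
edges `e 0, …, e n` are distinct, and `e i` joins `v i` to `v (i + 1)`, with indices modulo
`n + 1`. So a loop is a cycle of length one, and two parallel edges form a cycle of length
two. -/
def IsCycle (C : Graph α β) : Prop :=
  ∃ (n : ℕ) (v : Fin (n + 1) → α) (e : Fin (n + 1) → β),
    Function.Injective v ∧ Function.Injective e ∧
    Set.range v = V(C) ∧ Set.range e = E(C) ∧
    ∀ i : Fin (n + 1), C.IsLink (e i) (v i) (v (i + 1))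

/-- A multigraph is acyclic (a forest) if no subgraph of it is a cycle. -/
def IsAcyclic (G : Graph α β) : Prop :=
  ∀ C : Graph α β, C ≤ G → ¬ C.IsCycle

/-- A pseudoforest: every component contains at most one cycle. -/
def IsPseudoforest (G : Graph α β) : Prop :=
  ∀ K : Graph α β, K.IsComponent G →
    ∀ C C' : Graph α β, C ≤ K → C.IsCycle → C' ≤ K → C'.IsCycle → C = C'

/-- The graphs `P i` form a decomposition of `G`: they are spanning subgraphs of `G` whose edge
sets partition the edge set of `G` (parts may be empty). -/
structure IsDecomposition {ι : Type*} (G : Graph α β) (P : ι → Graph α β) : Prop where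
  spanning : ∀ i, (P i).IsSpanningSubgraph G
  disjoint : ∀ i j, i ≠ j → Disjoint E(P i) E(P j)
  cover : ⋃ i, E(P i) = E(G)

end Graph

/-!
# Decomposition into pseudoforests, one of which is a forest of small components

A *state* (`State`) colours the edges of the multigraph red and blue, such that the red edges form
a forest and the blue edges are oriented with out-degrees at most `k`. Giving the blue arcs that
leave a vertex different colours decomposes the blue edges into `k` graphs that are oriented with
out-degrees at most one, and those are pseudoforests (`isPseudoforest_of_injOn`). States exist by
Hall's theorem and an extremal argument (`exists_state`). So the point is to find a state in which
no red component is *bad* (`IsBad`), that is, violates the last condition of the theorem for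
some `z`. The other conditions follow from this one, with suitable values of `z`
(`exists_state_not_bad`, and the end of the proof of the theorem).

Suppose that every state has a bad component. In a state of minimal `State.badness`, a potential
that decreases when a bad component is replaced by smaller ones, explore the red components from a
bad one: repeatedly add a component that a blue arc leads to from a component found before. Choose
the state and the exploration such that the sequence of the orders of the components is
lexicographically minimal (`State.IsOptimal`). Then an exchange of edges must not shrink an explored
component without touching the earlier ones or creating a bad component (`no_improvement`). In a
typical exchange, a red edge at `x` becomes a blue arc leaving `x`, while a blue arc from `x` to a
later component becomes red (`no_exchange_at`); in another, a blue path is reversed in between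
(`isBad_merge`). Since these exchanges fail, for a blue arc from an explored component to a later
one, `C`:

* the order of `C` exceeds half the diameter of the tree that the arc would create
  (`half_joinDiam_lt`);
* this tree is bad (`isBad_join`);
* all such arcs from one component to small components leave the same vertex, so that there are at
  most `k` small components per component that they are explored from (`tail_eq_tail`).

Give a component with `n` vertices the weight `(k + 1) * (n - 1) - d`. Components of negative weight
are small, and the three facts show that each explored component has nonnegative weight together
with the small ones explored from it, and the bad one has positive weight together with them
(`sum_weight_pos`). On the other hand, every explored vertex has out-degree exactly `k`
(`outdeg_eq`), and all blue arcs leaving explored components stay among them, so that the explored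
vertices span so many edges that a positive total weight contradicts the density condition
(`le_card_edgesIn`, `card_edgesIn_le_of_mad_le`).
-/

namespace PseudoforestDecomposition

variable {V E : Type*}

/-! ### Distances, orders and diameters of the components of a simple graph -/

section Distance

/-- A walk whose component loses no edges from `G` to `G'` is also a walk in `G'`. -/
lemma exists_walk_length_eq {G G' : SimpleGraph V} {u v : V} (p : G.Walk u v)
    (h : ∀ a, G.Reachable u a → ∀ b, G.Adj a b → G'.Adj a b) :
    ∃ q : G'.Walk u v, q.length = p.length := by
  induction p with
  | nil => exact ⟨.nil, rfl⟩
  | cons hadj p ih =>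
    obtain ⟨q, hq⟩ := ih fun a ha b hab => h a (hadj.reachable.trans ha) b hab
    exact ⟨.cons (h _ .rfl _ hadj) q, by simp [hq]⟩

lemma reachable_congr {G G' : SimpleGraph V} {u : V}
    (h : ∀ a, G.Reachable u a → ∀ b, G.Adj a b ↔ G'.Adj a b) (b : V) :
    G'.Reachable u b ↔ G.Reachable u b := by
  constructor
  · rintro ⟨p⟩
    induction p with
    | nil => rfl
    | cons hadj p ih =>
      have h1 := (h _ .rfl _).2 hadj
      exact h1.reachable.trans (ih fun a ha b => h a (h1.reachable.trans ha) b)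
  · rintro ⟨p⟩
    obtain ⟨q, -⟩ := exists_walk_length_eq p fun a ha b hab => (h a ha b).1 hab
    exact ⟨q⟩

lemma dist_congr {G G' : SimpleGraph V} {u : V}
    (h : ∀ a, G.Reachable u a → ∀ b, G.Adj a b ↔ G'.Adj a b) (b : V) :
    G'.dist u b = G.dist u b := by
  by_cases hr : G.Reachable u b
  · have hr' := (reachable_congr h b).2 hr
    obtain ⟨p, hp⟩ := hr.exists_walk_length_eq_dist
    obtain ⟨p', hp'⟩ := hr'.exists_walk_length_eq_dist
    obtain ⟨q, hq⟩ := exists_walk_length_eq p fun a ha b hab => (h a ha b).1 hab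
    obtain ⟨q', hq'⟩ := exists_walk_length_eq p' fun a ha b hab =>
      (h a ((reachable_congr h a).1 ha) b).2 hab
    have := SimpleGraph.dist_le q
    have := SimpleGraph.dist_le q'
    omega
  · rw [SimpleGraph.dist_eq_zero_of_not_reachable hr,
      SimpleGraph.dist_eq_zero_of_not_reachable (mt (reachable_congr h b).1 hr)]

/-- A function that grows by at most one along each edge is bounded by the distance. -/
lemma le_add_dist {G : SimpleGraph V} {f : V → ℕ} (hf : ∀ a b, G.Adj a b → f b ≤ f a + 1)
    {a b : V} (h : G.Reachable a b) : f b ≤ f a + G.dist a b := by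
  obtain ⟨p, hp⟩ := h.exists_walk_length_eq_dist
  rw [← hp]
  clear hp h
  induction p with
  | nil => simp
  | cons hadj p ih =>
    have := hf _ _ hadj
    simp only [SimpleGraph.Walk.length_cons]
    omega

lemma dist_le_dist_add_one {G : SimpleGraph V} {a b c : V} (h : G.Reachable a b)
    (hbc : G.Adj b c) : G.dist a c ≤ G.dist a b + 1 := by
  obtain ⟨p, hp⟩ := h.exists_walk_length_eq_dist
  have := SimpleGraph.dist_le (p.concat hbc)
  simpa [hp] using this

/-- A geodesic leaves its starting point through a neighbour that is one step closer to the
target. -/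
lemma exists_adj_dist_add_one {G : SimpleGraph V} {a b : V} (h : G.Reachable a b) (hab : a ≠ b) :
    ∃ v, G.Adj a v ∧ G.Reachable v b ∧ G.dist v b + 1 = G.dist a b := by
  obtain ⟨p, hp⟩ := h.exists_walk_length_eq_dist
  cases p with
  | nil => exact absurd rfl hab
  | cons hadj p =>
    refine ⟨_, hadj, ⟨p⟩, ?_⟩
    have h1 := SimpleGraph.dist_le p
    obtain ⟨q, hq⟩ := SimpleGraph.Reachable.exists_walk_length_eq_dist (G := G) ⟨p⟩
    have h2 := SimpleGraph.dist_le (SimpleGraph.Walk.cons hadj q)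
    simp only [SimpleGraph.Walk.length_cons] at hp h2
    omega

end Distance

section Components

variable [Fintype V]

open scoped Classical in
/-- The vertex set of the component of `u`. -/
noncomputable def comp (G : SimpleGraph V) (u : V) : Finset V :=
  Finset.univ.filter (G.Reachable u)

/-- The number of vertices of the component of `u`. -/
noncomputable def order (G : SimpleGraph V) (u : V) : ℕ := (comp G u).card

/-- The eccentricity of `u` in its component: `SimpleGraph.dist` is `0` between different
components, so that the supremum may be taken over all vertices. -/
noncomputable def ecc (G : SimpleGraph V) (u : V) : ℕ := Finset.univ.sup (G.dist u)

/-- The diameter of the component of `u`. -/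
noncomputable def compDiam (G : SimpleGraph V) (u : V) : ℕ := (comp G u).sup (ecc G)

variable {G G' : SimpleGraph V} {u v a b : V}

@[simp] lemma mem_comp : a ∈ comp G u ↔ G.Reachable u a := by simp [comp]

lemma dist_le_ecc (G : SimpleGraph V) (u a : V) : G.dist u a ≤ ecc G u :=
  Finset.le_sup (f := G.dist u) (Finset.mem_univ a)

lemma exists_dist_eq_ecc (G : SimpleGraph V) (u : V) :
    ∃ a, G.Reachable u a ∧ G.dist u a = ecc G u := by
  obtain ⟨a, -, ha⟩ := Finset.exists_mem_eq_sup Finset.univ ⟨u, Finset.mem_univ u⟩ (G.dist u)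
  by_cases h : G.Reachable u a
  · exact ⟨a, h, ha.symm⟩
  · rw [SimpleGraph.dist_eq_zero_of_not_reachable h] at ha
    exact ⟨u, .rfl, by rw [SimpleGraph.dist_self]; exact ha.symm⟩

lemma ecc_le_iff {m : ℕ} : ecc G u ≤ m ↔ ∀ a, G.Reachable u a → G.dist u a ≤ m := by
  constructor
  · exact fun h a _ => (dist_le_ecc G u a).trans h
  · intro h
    obtain ⟨a, ha, hd⟩ := exists_dist_eq_ecc G u
    exact hd ▸ h a ha

lemma comp_eq (h : G.Reachable u v) : comp G u = comp G v := by
  ext a; simp only [mem_comp]; exact ⟨h.symm.trans, h.trans⟩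

lemma order_eq (h : G.Reachable u v) : order G u = order G v := by rw [order, order, comp_eq h]

lemma compDiam_eq (h : G.Reachable u v) : compDiam G u = compDiam G v := by
  rw [compDiam, compDiam, comp_eq h]

lemma dist_le_compDiam (ha : G.Reachable u a) (b : V) : G.dist a b ≤ compDiam G u :=
  (dist_le_ecc G a b).trans (Finset.le_sup (f := ecc G) (by simpa using ha))

lemma ecc_le_compDiam (G : SimpleGraph V) (u : V) : ecc G u ≤ compDiam G u :=
  Finset.le_sup (f := ecc G) (by simp)

lemma compDiam_le_iff {m : ℕ} : compDiam G u ≤ m ↔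
    ∀ a b, G.Reachable u a → G.Reachable u b → G.dist a b ≤ m := by
  constructor
  · exact fun h a b ha _ => (dist_le_compDiam ha b).trans h
  · intro h
    refine Finset.sup_le fun a ha => ecc_le_iff.2 fun b hb => ?_
    rw [mem_comp] at ha
    exact h a b ha (ha.trans hb)

lemma compDiam_le_two_mul_ecc (G : SimpleGraph V) (u : V) : compDiam G u ≤ 2 * ecc G u := by
  refine compDiam_le_iff.2 fun a b ha hb => ?_
  have h1 := ha.symm.dist_triangle_left b
  have h2 := dist_le_ecc G u a
  have h3 := dist_le_ecc G u b
  rw [SimpleGraph.dist_comm] at h2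
  omega

lemma ecc_lt_order (G : SimpleGraph V) (u : V) : ecc G u < order G u := by
  obtain ⟨a, ha, hd⟩ := exists_dist_eq_ecc G u
  rw [← hd]
  obtain ⟨p, hp, hl⟩ := ha.exists_path_of_dist
  classical
  have h1 : p.support.toFinset ⊆ comp G u := fun b hb => by
    rw [mem_comp]
    exact ⟨p.takeUntil b (by simpa using hb)⟩
  have h2 := Finset.card_le_card h1
  rw [List.toFinset_card_of_nodup hp.support_nodup, SimpleGraph.Walk.length_support, hl] at h2
  exact h2

lemma compDiam_lt_order (G : SimpleGraph V) (u : V) : compDiam G u < order G u := by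
  obtain ⟨a, ha, hd⟩ := Finset.exists_mem_eq_sup (comp G u) ⟨u, by simp⟩ (ecc G)
  rw [compDiam, hd, order_eq (mem_comp.1 ha)]
  exact ecc_lt_order G a

lemma order_pos (G : SimpleGraph V) (u : V) : 0 < order G u := by
  have := ecc_lt_order G u; omega

lemma order_le_card (G : SimpleGraph V) (u : V) : order G u ≤ Fintype.card V :=
  Finset.card_le_univ _

lemma exists_reachable_ne (h : 2 ≤ order G u) : ∃ a, G.Reachable u a ∧ a ≠ u := by
  obtain ⟨a, ha, hne⟩ := Finset.exists_mem_ne (s := comp G u) h u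
  exact ⟨a, by simpa using ha, hne⟩

lemma eq_of_order_le_one (h : order G u ≤ 1) (ha : G.Reachable u a) : a = u := by
  by_contra hne
  have : 1 < (comp G u).card := Finset.one_lt_card.2 ⟨a, by simpa, u, by simp, hne⟩
  exact absurd h (by simpa [order] using this)

lemma comp_congr (h : ∀ a, G.Reachable u a → ∀ b, G.Adj a b ↔ G'.Adj a b) :
    comp G' u = comp G u := by
  ext a; simp [reachable_congr h]

lemma order_congr (h : ∀ a, G.Reachable u a → ∀ b, G.Adj a b ↔ G'.Adj a b) :
    order G' u = order G u := by rw [order, order, comp_congr h]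

lemma ecc_congr (h : ∀ a, G.Reachable u a → ∀ b, G.Adj a b ↔ G'.Adj a b) :
    ecc G' u = ecc G u := by
  unfold ecc; congr 1; ext b; exact dist_congr h b

lemma compDiam_congr (h : ∀ a, G.Reachable u a → ∀ b, G.Adj a b ↔ G'.Adj a b) :
    compDiam G' u = compDiam G u := by
  rw [compDiam, compDiam, comp_congr h]
  refine Finset.sup_congr rfl fun a ha => ecc_congr fun b hb c => h b ?_ c
  exact (mem_comp.1 ha).trans hb

end Components

/-! ### Joining two components by an edge, and forests in multigraphs -/

/-- `G'` arises from `G` by adding an edge `pq` between two different components. -/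
structure Joins (G G' : SimpleGraph V) (p q : V) : Prop where
  adj_iff : ∀ a b, G'.Adj a b ↔ G.Adj a b ∨ (a = p ∧ b = q) ∨ (a = q ∧ b = p)
  not_reachable : ¬ G.Reachable p q

namespace Joins

variable {G G' : SimpleGraph V} {p q a b u : V}

lemma symm (h : Joins G G' p q) : Joins G G' q p where
  adj_iff a b := by rw [h.adj_iff]; tauto
  not_reachable := fun hr => h.not_reachable hr.symm

lemma le (h : Joins G G' p q) : G ≤ G' := fun a b hab => (h.adj_iff a b).2 (Or.inl hab)

lemma adj (h : Joins G G' p q) : G'.Adj p q := (h.adj_iff p q).2 (by simp)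

lemma reachable_iff (h : Joins G G' p q) : G'.Reachable a b ↔
    G.Reachable a b ∨ (G.Reachable a p ∧ G.Reachable q b) ∨
      (G.Reachable a q ∧ G.Reachable p b) := by
  constructor
  · rintro ⟨w⟩
    induction w with
    | nil => exact Or.inl .rfl
    | @cons x y z hadj w ih =>
      rcases (h.adj_iff _ _).1 hadj with h1 | ⟨rfl, rfl⟩ | ⟨rfl, rfl⟩
      · have := h1.reachable
        rcases ih with h2 | ⟨h2, h3⟩ | ⟨h2, h3⟩
        · exact Or.inl (this.trans h2)
        · exact Or.inr (Or.inl ⟨this.trans h2, h3⟩)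
        · exact Or.inr (Or.inr ⟨this.trans h2, h3⟩)
      · rcases ih with h2 | ⟨h2, h3⟩ | ⟨h2, h3⟩
        · exact Or.inr (Or.inl ⟨.rfl, h2⟩)
        · exact absurd h2.symm h.not_reachable
        · exact Or.inl h3
      · rcases ih with h2 | ⟨h2, h3⟩ | ⟨h2, h3⟩
        · exact Or.inr (Or.inr ⟨.rfl, h2⟩)
        · exact Or.inl h3
        · exact absurd h2 h.not_reachable
  · rintro (h1 | ⟨h1, h2⟩ | ⟨h1, h2⟩)
    · exact h1.mono h.le
    · exact ((h1.mono h.le).trans h.adj.reachable).trans (h2.mono h.le)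
    · exact ((h1.mono h.le).trans h.adj.reachable.symm).trans (h2.mono h.le)

lemma reachable_left_iff (h : Joins G G' p q) :
    G'.Reachable p b ↔ G.Reachable p b ∨ G.Reachable q b := by
  rw [h.reachable_iff]
  have := h.not_reachable
  constructor
  · rintro (h1 | ⟨-, h1⟩ | ⟨h1, -⟩)
    · exact Or.inl h1
    · exact Or.inr h1
    · exact absurd h1 this
  · rintro (h1 | h1)
    · exact Or.inl h1
    · exact Or.inr (Or.inl ⟨.rfl, h1⟩)

lemma congr_off (h : Joins G G' p q) (hp : ¬ G.Reachable u p) (hq : ¬ G.Reachable u q) :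
    ∀ a, G.Reachable u a → ∀ b, G.Adj a b ↔ G'.Adj a b := by
  intro a ha b
  rw [h.adj_iff]
  constructor
  · exact Or.inl
  · rintro (h1 | ⟨rfl, rfl⟩ | ⟨rfl, rfl⟩)
    · exact h1
    · exact absurd ha hp
    · exact absurd ha hq

/-- Distances from `a` after joining. The lower bounds hold because the function that is
`G.dist a` on the component of `a`, `G.dist a p + 1 + G.dist q` on that of `q` and `0` elsewhere
grows by at most one along each edge of `G'`. -/
lemma dist_eq_and (h : Joins G G' p q) (ha : G.Reachable a p) :
    (∀ b, G.Reachable a b → G'.dist a b = G.dist a b) ∧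
    (∀ b, G.Reachable q b → G'.dist a b = G.dist a p + 1 + G.dist q b) := by
  classical
  have hnot : ∀ b, G.Reachable a b → ¬ G.Reachable q b := fun b h1 h2 =>
    h.not_reachable (ha.symm.trans (h1.trans h2.symm))
  let f : V → ℕ := fun b =>
    if G.Reachable a b then G.dist a b
    else if G.Reachable q b then G.dist a p + 1 + G.dist q b else 0
  have hf : ∀ b c, G'.Adj b c → f c ≤ f b + 1 := by
    intro b c hbc
    rcases (h.adj_iff _ _).1 hbc with h1 | ⟨rfl, rfl⟩ | ⟨rfl, rfl⟩
    · have hr := h1.reachable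
      have e1 : G.Reachable a b ↔ G.Reachable a c :=
        ⟨fun x => x.trans hr, fun x => x.trans hr.symm⟩
      have e2 : G.Reachable q b ↔ G.Reachable q c :=
        ⟨fun x => x.trans hr, fun x => x.trans hr.symm⟩
      simp only [f, ← e1, ← e2]
      split_ifs with i1 i2
      · exact dist_le_dist_add_one i1 h1
      · have := dist_le_dist_add_one i2 h1
        omega
      · omega
    · have h1 : ¬ G.Reachable a c := fun h1 => hnot c h1 .rfl
      simp [f, h1, ha]
    · have h1 : ¬ G.Reachable a b := fun h1 => hnot b h1 .rfl
      simp [f, h1, ha]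
      omega
  have hfa : f a = 0 := by simp [f]
  refine ⟨fun b hb => ?_, fun b hb => ?_⟩
  · have hb' := hb.mono h.le
    refine le_antisymm (SimpleGraph.Reachable.dist_anti h.le hb) ?_
    have := le_add_dist hf hb'
    simpa [hfa, f, hb] using this
  · have hb' : G'.Reachable a b := h.reachable_iff.2 (Or.inr (Or.inl ⟨ha, hb⟩))
    have hnb : ¬ G.Reachable a b := fun h1 => hnot b h1 hb
    refine le_antisymm ?_ ?_
    · obtain ⟨w1, hw1⟩ := (ha.mono h.le).exists_walk_length_eq_dist
      obtain ⟨w2, hw2⟩ := (hb.mono h.le).exists_walk_length_eq_dist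
      have h1 := SimpleGraph.dist_le ((w1.concat h.adj).append w2)
      have h2 := SimpleGraph.Reachable.dist_anti h.le ha
      have h3 := SimpleGraph.Reachable.dist_anti h.le hb
      simp only [SimpleGraph.Walk.length_append, SimpleGraph.Walk.length_concat] at h1
      omega
    · have := le_add_dist hf hb'
      simpa [hfa, f, hb, hnb] using this

lemma dist_across (h : Joins G G' p q) (ha : G.Reachable p a) (hb : G.Reachable q b) :
    G'.dist a b = G.dist p a + 1 + G.dist q b := by
  rw [(h.dist_eq_and ha.symm).2 b hb, SimpleGraph.dist_comm]

lemma dist_of_reachable (h : Joins G G' p q) (hab : G.Reachable a b) :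
    G'.dist a b = G.dist a b := by
  by_cases hp : G.Reachable a p
  · exact (h.dist_eq_and hp).1 b hab
  by_cases hq : G.Reachable a q
  · exact (h.symm.dist_eq_and hq).1 b hab
  · exact dist_congr (h.congr_off hp hq) b

variable [Fintype V]

lemma order_add (h : Joins G G' p q) : order G' p = order G p + order G q := by
  classical
  have h1 : comp G' p = comp G p ∪ comp G q := by
    ext b; simp [h.reachable_left_iff]
  rw [order, h1, Finset.card_union_of_disjoint, order, order]
  rw [Finset.disjoint_left]
  intro b hb hb'
  rw [mem_comp] at hb hb'
  exact h.not_reachable (hb.trans hb'.symm)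

lemma ecc_left (h : Joins G G' p q) : ecc G' p = max (ecc G p) (1 + ecc G q) := by
  refine le_antisymm (ecc_le_iff.2 fun a ha => ?_) (max_le ?_ ?_)
  · rcases h.reachable_left_iff.1 ha with h1 | h1
    · rw [h.dist_of_reachable h1]
      exact le_max_of_le_left (dist_le_ecc G p a)
    · rw [h.dist_across .rfl h1, SimpleGraph.dist_self]
      have := dist_le_ecc G q a
      exact le_max_of_le_right (by omega)
  · refine ecc_le_iff.2 fun a ha => ?_
    rw [← h.dist_of_reachable ha]
    exact dist_le_ecc G' p a
  · obtain ⟨a, ha, hd⟩ := exists_dist_eq_ecc G q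
    have h1 := h.dist_across .rfl ha
    have h2 := dist_le_ecc G' p a
    rw [SimpleGraph.dist_self] at h1
    omega

lemma compDiam_left (h : Joins G G' p q) :
    compDiam G' p = max (max (compDiam G p) (compDiam G q)) (ecc G p + 1 + ecc G q) := by
  refine le_antisymm (compDiam_le_iff.2 fun a b ha hb => ?_) (max_le (max_le ?_ ?_) ?_)
  · rcases h.reachable_left_iff.1 ha with h1 | h1 <;> rcases h.reachable_left_iff.1 hb with h2 | h2
    · rw [h.dist_of_reachable (h1.symm.trans h2)]
      exact le_max_of_le_left (le_max_of_le_left (dist_le_compDiam h1 b))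
    · rw [h.dist_across h1 h2]
      have := dist_le_ecc G p a
      have := dist_le_ecc G q b
      exact le_max_of_le_right (by omega)
    · rw [SimpleGraph.dist_comm, h.dist_across h2 h1]
      have := dist_le_ecc G p b
      have := dist_le_ecc G q a
      exact le_max_of_le_right (by omega)
    · rw [h.dist_of_reachable (h1.symm.trans h2)]
      exact le_max_of_le_left (le_max_of_le_right (dist_le_compDiam h1 b))
  · refine compDiam_le_iff.2 fun a b ha hb => ?_
    rw [← h.dist_of_reachable (ha.symm.trans hb)]
    exact dist_le_compDiam (h.reachable_left_iff.2 (Or.inl ha)) b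
  · refine compDiam_le_iff.2 fun a b ha hb => ?_
    rw [← h.dist_of_reachable (ha.symm.trans hb)]
    exact dist_le_compDiam (h.reachable_left_iff.2 (Or.inr ha)) b
  · obtain ⟨a, ha, hd⟩ := exists_dist_eq_ecc G p
    obtain ⟨b, hb, hd'⟩ := exists_dist_eq_ecc G q
    rw [← hd, ← hd', ← h.dist_across ha hb]
    exact dist_le_compDiam (h.reachable_left_iff.2 (Or.inl ha)) b

lemma compDiam_le (h : Joins G G' p q) : compDiam G p ≤ compDiam G' p := by
  rw [h.compDiam_left]
  exact le_max_of_le_left (le_max_left _ _)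

lemma ecc_le (h : Joins G G' p q) : ecc G p ≤ ecc G' p := by
  rw [h.ecc_left]
  exact le_max_left _ _

end Joins

section EdgeSets

variable {inc : E → Sym2 V} {R : Set E} {e e' : E} {x x' v v' u a b : V}

/-- The simple graph of a set `R` of edges of the multigraph with incidence map `inc`:
loops are dropped, parallel edges identified. -/
def edgeGraph (inc : E → Sym2 V) (R : Set E) : SimpleGraph V where
  Adj a b := a ≠ b ∧ ∃ e ∈ R, inc e = s(a, b)
  symm := ⟨fun a b ⟨h, e, he, hi⟩ => ⟨h.symm, e, he, by rw [hi, Sym2.eq_swap]⟩⟩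
  loopless := ⟨fun _ h => h.1 rfl⟩

lemma edgeGraph_adj : (edgeGraph inc R).Adj a b ↔ a ≠ b ∧ ∃ e ∈ R, inc e = s(a, b) := Iff.rfl

lemma edgeGraph_mono {R R' : Set E} (h : R ⊆ R') : edgeGraph inc R ≤ edgeGraph inc R' :=
  fun _ _ ⟨hab, e, he, hi⟩ => ⟨hab, e, h he, hi⟩

lemma reachable_of_mem (he : e ∈ R) (hi : inc e = s(a, b)) : (edgeGraph inc R).Reachable a b := by
  by_cases hab : a = b
  · exact hab ▸ .rfl
  · exact SimpleGraph.Adj.reachable ⟨hab, e, he, hi⟩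

/-- A set of edges is a forest if each of its edges is a bridge. In contrast to acyclicity of
`edgeGraph inc R`, this also forbids loops and parallel edges. -/
def IsForest (inc : E → Sym2 V) (R : Set E) : Prop :=
  ∀ e ∈ R, ∀ a b, inc e = s(a, b) → ¬ (edgeGraph inc (R \ {e})).Reachable a b

lemma joins_insert (hi : inc e = s(a, b)) (h : ¬ (edgeGraph inc R).Reachable a b) :
    Joins (edgeGraph inc R) (edgeGraph inc (insert e R)) a b where
  not_reachable := h
  adj_iff c d := by
    have hab : a ≠ b := fun hab => h (hab ▸ .rfl)
    simp only [edgeGraph_adj, Set.mem_insert_iff]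
    constructor
    · rintro ⟨hcd, f, rfl | hf, hf'⟩
      · rw [hi, Sym2.eq_iff] at hf'
        rcases hf' with ⟨rfl, rfl⟩ | ⟨rfl, rfl⟩ <;> tauto
      · exact Or.inl ⟨hcd, f, hf, hf'⟩
    · rintro (⟨hcd, f, hf, hf'⟩ | ⟨rfl, rfl⟩ | ⟨rfl, rfl⟩)
      · exact ⟨hcd, f, Or.inr hf, hf'⟩
      · exact ⟨hab, e, Or.inl rfl, hi⟩
      · exact ⟨hab.symm, e, Or.inl rfl, by rw [hi, Sym2.eq_swap]⟩

lemma IsForest.joins (hR : IsForest inc R) (he : e ∈ R) (hi : inc e = s(a, b)) :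
    Joins (edgeGraph inc (R \ {e})) (edgeGraph inc R) a b := by
  have := joins_insert hi (hR e he a b hi)
  rwa [Set.insert_sdiff_singleton, Set.insert_eq_of_mem he] at this

lemma IsForest.mono {R R' : Set E} (hR : IsForest inc R') (h : R ⊆ R') : IsForest inc R :=
  fun e he a b hi hr =>
    hR e (h he) a b hi (hr.mono (edgeGraph_mono (Set.sdiff_subset_sdiff_left h)))

lemma IsForest.insert_edge (hR : IsForest inc R) (hi : inc e = s(a, b))
    (h : ¬ (edgeGraph inc R).Reachable a b) : IsForest inc (insert e R) := by
  intro f hf c d hfi hr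
  by_cases hfe : f = e
  · subst hfe
    have h1 : (edgeGraph inc R).Reachable c d := hr.mono (edgeGraph_mono (by
      rintro g ⟨rfl | hg, hg'⟩
      · exact absurd rfl hg'
      · exact hg))
    rw [hi, Sym2.eq_iff] at hfi
    rcases hfi with ⟨rfl, rfl⟩ | ⟨rfl, rfl⟩
    · exact h h1
    · exact h h1.symm
  · have hfR : f ∈ R := Set.mem_of_mem_insert_of_ne hf hfe
    have hsub : R \ {f} ⊆ R := Set.sdiff_subset
    have hJ := joins_insert (R := R \ {f}) hi fun h1 => h (h1.mono (edgeGraph_mono hsub))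
    have h2 : insert e R \ {f} = insert e (R \ {f}) := by
      ext g
      simp only [Set.mem_sdiff, Set.mem_insert_iff, Set.mem_singleton_iff]
      constructor
      · tauto
      · rintro (rfl | ⟨h1, h2⟩)
        · exact ⟨Or.inl rfl, fun h => hfe h.symm⟩
        · exact ⟨Or.inr h1, h2⟩
    rw [h2, hJ.reachable_iff] at hr
    have hcd := reachable_of_mem (R := R) hfR hfi
    have hm := fun {c d} (h : (edgeGraph inc (R \ {f})).Reachable c d) =>
      h.mono (edgeGraph_mono hsub)
    rcases hr with h1 | ⟨h1, h2⟩ | ⟨h1, h2⟩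
    · exact hR f hfR c d hfi h1
    · exact h ((hm h1).symm.trans (hcd.trans (hm h2).symm))
    · exact h ((hm h2).trans (hcd.symm.trans (hm h1)))

/-- In a forest, some edge at `x` separates `x` from `u`. -/
lemma IsForest.exists_cut (hR : IsForest inc R) (h : (edgeGraph inc R).Reachable x u)
    (hxu : x ≠ u) : ∃ e ∈ R, ∃ v, inc e = s(x, v) ∧ (edgeGraph inc (R \ {e})).Reachable v u := by
  obtain ⟨v, ⟨-, e, he, hi⟩, hvu, hd⟩ := exists_adj_dist_add_one h hxu
  refine ⟨e, he, v, hi, ?_⟩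
  have hJ := hR.joins he hi
  rcases hJ.reachable_left_iff.1 h with h1 | h1
  · have h2 := hJ.symm.dist_across .rfl h1
    have h3 := hJ.dist_of_reachable h1
    rw [SimpleGraph.dist_self] at h2
    omega
  · exact h1

/-- Two vertices `x`, `x'` of a tree, the edge `e` at `x` on the path to `x'`, and the edge `e'`
at `x'` on the path to `x`: the part behind `x'` lies on the far side of `e`. -/
lemma IsForest.reachable_of_cut_of_cut (hR : IsForest inc R) (he : e ∈ R) (he' : e' ∈ R)
    (hi : inc e = s(x, v)) (hi' : inc e' = s(x', v'))
    (h : (edgeGraph inc (R \ {e})).Reachable v x')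
    (h' : (edgeGraph inc (R \ {e'})).Reachable v' x)
    (ha : (edgeGraph inc (R \ {e'})).Reachable x' a) :
    (edgeGraph inc (R \ {e})).Reachable v a := by
  have hJ := hR.joins he hi
  have hJ' := hR.joins he' hi'
  have hxx' : (edgeGraph inc R).Reachable x x' := hJ.reachable_left_iff.2 (Or.inr h)
  have hxa : (edgeGraph inc R).Reachable x a :=
    hxx'.trans (hJ'.reachable_left_iff.2 (Or.inl ha))
  rcases hJ.reachable_left_iff.1 hxa with h1 | h1
  swap
  · exact h1
  exfalso
  -- the path from `x` to `a` avoids `e`, hence `x'`, hence `e'`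
  have h2 : (edgeGraph inc (R \ {e'})).Reachable x a := by
    obtain ⟨p⟩ := h1
    obtain ⟨q, -⟩ := exists_walk_length_eq (G' := edgeGraph inc (R \ {e'})) p
      fun c hc d hcd => by
        obtain ⟨hne, f, hf, hfi⟩ := hcd
        refine ⟨hne, f, ⟨hf.1, ?_⟩, hfi⟩
        rintro rfl
        have hcd : (edgeGraph inc (R \ {e})).Reachable c d := reachable_of_mem hf hfi
        rw [hi', Sym2.eq_iff] at hfi
        rcases hfi with ⟨rfl, rfl⟩ | ⟨rfl, rfl⟩
        · exact hJ.not_reachable (hc.trans h.symm)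
        · exact hJ.not_reachable ((hc.trans hcd).trans h.symm)
    exact ⟨q⟩
  exact hJ'.not_reachable (ha.trans (h2.symm.trans h'.symm))

variable [Fintype V]

lemma IsForest.exists_cut_ecc (hR : IsForest inc R) (h : 0 < ecc (edgeGraph inc R) x) :
    ∃ e ∈ R, ∃ v, inc e = s(x, v) ∧
      ecc (edgeGraph inc R) x = ecc (edgeGraph inc (R \ {e})) v + 1 := by
  obtain ⟨u, hu, hd⟩ := exists_dist_eq_ecc (edgeGraph inc R) x
  have hxu : x ≠ u := by
    rintro rfl
    rw [SimpleGraph.dist_self] at hd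
    omega
  obtain ⟨e, he, v, hi, hvu⟩ := hR.exists_cut hu hxu
  refine ⟨e, he, v, hi, ?_⟩
  have hJ := hR.joins he hi
  have h1 := hJ.dist_across .rfl hvu
  rw [SimpleGraph.dist_self] at h1
  have h2 := dist_le_ecc (edgeGraph inc (R \ {e})) v u
  have h3 := hJ.ecc_left
  omega

/-- The parts of a tree beyond the two cuts of `IsForest.reachable_of_cut_of_cut` are disjoint
and lie at distance at least one from each other. -/
lemma IsForest.order_ecc_of_cut_of_cut (hR : IsForest inc R) (he : e ∈ R) (he' : e' ∈ R)
    (hi : inc e = s(x, v)) (hi' : inc e' = s(x', v'))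
    (h : (edgeGraph inc (R \ {e})).Reachable v x')
    (h' : (edgeGraph inc (R \ {e'})).Reachable v' x) :
    order (edgeGraph inc (R \ {e'})) x' ≤ order (edgeGraph inc (R \ {e})) v ∧
    ecc (edgeGraph inc (R \ {e})) x + 1 + ecc (edgeGraph inc (R \ {e'})) x' ≤
      compDiam (edgeGraph inc R) x := by
  have hJ := hR.joins he hi
  have hJ' := hR.joins he' hi'
  have hsub := fun {a} (ha : (edgeGraph inc (R \ {e'})).Reachable x' a) =>
    hR.reachable_of_cut_of_cut he he' hi hi' h h' ha
  constructor
  · refine Finset.card_le_card fun a ha => ?_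
    rw [mem_comp] at ha ⊢
    exact hsub ha
  · obtain ⟨a, ha, hda⟩ := exists_dist_eq_ecc (edgeGraph inc (R \ {e})) x
    obtain ⟨b, hb, hdb⟩ := exists_dist_eq_ecc (edgeGraph inc (R \ {e'})) x'
    have h1 := hJ.dist_across ha (hsub hb)
    have h2 := hJ.dist_across .rfl (hsub hb)
    have h3 := hJ'.dist_across hb h'
    rw [SimpleGraph.dist_comm] at h3
    rw [SimpleGraph.dist_self] at h2
    have h4 := dist_le_compDiam (hJ.reachable_left_iff.2 (Or.inl ha)) b
    omega

end EdgeSets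

/-! ### Orientations, exchanges, and the existence of states -/

/-- An orientation of the edges of the multigraph with incidence map `inc`. -/
structure Orientation (inc : E → Sym2 V) where
  /-- the tail of an edge -/
  tail : E → V
  /-- the head of an edge -/
  head : E → V
  inc_eq : ∀ e, inc e = s(tail e, head e)

namespace Orientation

variable {inc : E → Sym2 V}

open scoped Classical in
/-- The orientation that agrees with `o`, except that `e` points from `x` to `v`. -/
noncomputable def redirect (o : Orientation inc) (e : E) (x v : V) (h : inc e = s(x, v)) :
    Orientation inc where
  tail := Function.update o.tail e x
  head := Function.update o.head e v
  inc_eq f := by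
    by_cases hf : f = e
    · subst hf; simpa using h
    · simpa [hf] using o.inc_eq f

/-- An arc outside the set `R` that leads from a vertex of `S` to `b`. -/
def Step (o : Orientation inc) (R : Set E) (S : Set V) (a b : V) : Prop :=
  a ∈ S ∧ ∃ e ∉ R, o.tail e = a ∧ o.head e = b

lemma Step.mono {o : Orientation inc} {R : Set E} {S S' : Set V} (h : S ⊆ S') {a b : V}
    (hs : o.Step R S a b) : o.Step R S' a b := ⟨h hs.1, hs.2⟩

/-- The number of arcs outside the set `R` with tail `v`. -/
noncomputable def outdeg (o : Orientation inc) (R : Set E) (v : V) : ℕ :=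
  {e | e ∉ R ∧ o.tail e = v}.ncard

open scoped Classical in
lemma outdeg_insert [Finite E] (o : Orientation inc) {R : Set E} {e : E} (he : e ∉ R) (v : V) :
    o.outdeg (insert e R) v + (if v = o.tail e then 1 else 0) = o.outdeg R v := by
  unfold outdeg
  split_ifs with h
  · have h1 : {f | f ∉ R ∧ o.tail f = v} = insert e {f | f ∉ insert e R ∧ o.tail f = v} := by
      ext f
      simp only [Set.mem_ofPred_eq, Set.mem_insert_iff]
      constructor
      · tauto
      · rintro (rfl | h1)
        · exact ⟨he, h.symm⟩
        · tauto
    rw [h1, Set.ncard_insert_of_notMem (by simp)]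
  · rw [add_zero]
    congr 1
    ext f
    simp only [Set.mem_ofPred_eq, Set.mem_insert_iff]
    constructor
    · tauto
    · rintro ⟨h1, h2⟩
      refine ⟨?_, h2⟩
      rintro (rfl | h3)
      · exact h h2.symm
      · exact h1 h3

lemma outdeg_congr {o o' : Orientation inc} {R : Set E}
    (h : ∀ e ∉ R, o'.tail e = o.tail e) (v : V) : o'.outdeg R v = o.outdeg R v := by
  unfold outdeg
  congr 1
  ext e
  simp only [Set.mem_ofPred_eq]
  constructor
  · rintro ⟨h1, h2⟩
    exact ⟨h1, (h e h1) ▸ h2⟩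
  · rintro ⟨h1, h2⟩
    exact ⟨h1, (h e h1).trans h2⟩

lemma redirect_tail_of_ne (o : Orientation inc) {e f : E} {x v : V} (h : inc e = s(x, v))
    (hf : f ≠ e) : (o.redirect e x v h).tail f = o.tail f := by simp [redirect, hf]

lemma redirect_head_of_ne (o : Orientation inc) {e f : E} {x v : V} (h : inc e = s(x, v))
    (hf : f ≠ e) : (o.redirect e x v h).head f = o.head f := by simp [redirect, hf]

lemma redirect_tail_self (o : Orientation inc) {e : E} {x v : V} (h : inc e = s(x, v)) :
    (o.redirect e x v h).tail e = x := by simp [redirect]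

open scoped Classical in
lemma outdeg_redirect [Finite E] (o : Orientation inc) {R : Set E} {e : E} {x v : V}
    (h : inc e = s(x, v)) (he : e ∉ R) (u : V) :
    (o.redirect e x v h).outdeg R u + (if u = o.tail e then 1 else 0) =
      o.outdeg R u + (if u = x then 1 else 0) := by
  have h1 := (o.redirect e x v h).outdeg_insert he u
  have h2 := o.outdeg_insert he u
  have h3 : (o.redirect e x v h).outdeg (insert e R) u = o.outdeg (insert e R) u :=
    outdeg_congr (fun f hf => o.redirect_tail_of_ne h
      (fun hfe => hf (hfe ▸ Set.mem_insert _ _))) u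
  rw [redirect_tail_self] at h1
  omega

/-- The part of a directed path after its last visit to its starting point. -/
lemma exists_step_of_reflTransGen {o : Orientation inc} {R : Set E} {S : Set V} {x z : V}
    (h : Relation.ReflTransGen (o.Step R S) x z) (hxz : x ≠ z) :
    ∃ y, o.Step R S x y ∧ Relation.ReflTransGen (o.Step R (S \ {x})) y z := by
  induction h with
  | refl => exact absurd rfl hxz
  | @tail b c hb hbc ih =>
    by_cases hxb : x = b
    · subst hxb
      exact ⟨c, hbc, .refl⟩
    · obtain ⟨y, hy, hyb⟩ := ih hxb
      exact ⟨y, hy, hyb.tail ⟨⟨hbc.1, fun h => hxb h.symm⟩, hbc.2⟩⟩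

open scoped Classical in
/-- Reversing a directed path from `x` to `z` moves one unit of out-degree from `x` to `z`. -/
theorem exists_reverse [Finite V] [Finite E] (o : Orientation inc) (R : Set E) (S : Set V) {x z : V}
    (h : Relation.ReflTransGen (o.Step R S) x z) :
    ∃ o' : Orientation inc,
      (∀ v, o'.outdeg R v + (if v = x then 1 else 0) = o.outdeg R v + (if v = z then 1 else 0)) ∧
      ∀ e, e ∈ R ∨ o.tail e ∉ S → o'.tail e = o.tail e ∧ o'.head e = o.head e := by
  induction hn : S.ncard using Nat.strong_induction_on generalizing S x with
  | _ n ih =>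
    by_cases hxz : x = z
    · subst hxz
      exact ⟨o, fun v => rfl, fun e _ => ⟨rfl, rfl⟩⟩
    obtain ⟨y, ⟨hxS, e, heR, het, heh⟩, hyz⟩ := exists_step_of_reflTransGen h hxz
    have hlt : (S \ {x}).ncard < n := hn ▸ Set.ncard_sdiff_singleton_lt_of_mem hxS
    obtain ⟨o', ho', hoe⟩ := ih _ hlt (S \ {x}) hyz rfl
    have hx : o.tail e ∉ S \ {x} := fun h => h.2 het
    have hi : inc e = s(y, x) := by rw [o.inc_eq, het, heh, Sym2.eq_swap]
    refine ⟨o'.redirect e y x hi, fun v => ?_, fun f hf => ?_⟩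
    · have h1 := o'.outdeg_redirect hi heR v
      have h2 := ho' v
      rw [(hoe e (Or.inr hx)).1, het] at h1
      omega
    · have hfe : f ≠ e := by
        rintro rfl
        rcases hf with hf | hf
        · exact heR hf
        · exact hf (het ▸ hxS)
      rw [redirect_tail_of_ne _ _ hfe, redirect_head_of_ne _ _ hfe]
      exact hoe f (hf.imp_right fun h1 h2 => h1 h2.1)

end Orientation

/-- A decomposition of the edges into a forest `red` and a set of remaining ('blue') edges that
is oriented with out-degrees at most `k`. -/
structure State (inc : E → Sym2 V) (k : ℕ) where
  /-- the edges of the forest -/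
  red : Set E
  /-- the orientation; only its values on the blue edges matter -/
  o : Orientation inc
  forest : IsForest inc red
  outdeg_le : ∀ v, o.outdeg red v ≤ k

namespace State

variable {inc : E → Sym2 V} {k : ℕ}

/-- The forest of red edges, as a simple graph. -/
def graph (s : State inc k) : SimpleGraph V := edgeGraph inc s.red

/-- The basic exchange: the red edge `e` at `x` becomes a blue arc leaving `x`, the blue path
from `x` to `z` is reversed, and the blue arc `f` leaving `z` becomes red. -/
lemma exists_exchange [Finite V] [Finite E] (s : State inc k) {e f : E} {x v z : V} {S : Set V}
    (he : e ∈ s.red) (hi : inc e = s(x, v)) (hS : Relation.ReflTransGen (s.o.Step s.red S) x z)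
    (hz : z ∉ S) (hf : f ∉ s.red) (hfz : s.o.tail f = z)
    (hF : IsForest inc (insert f (s.red \ {e}))) :
    ∃ s' : State inc k, s'.red = insert f (s.red \ {e}) ∧
      ∀ g, g ∉ s.red → g ≠ f → s.o.tail g ∉ S →
        g ∉ s'.red ∧ s'.o.tail g = s.o.tail g ∧ s'.o.head g = s.o.head g := by
  classical
  obtain ⟨o', ho', hoe⟩ := s.o.exists_reverse s.red S hS
  have hfe : f ≠ e := fun h => hf (h ▸ he)
  refine ⟨⟨_, o'.redirect e x v hi, hF, fun u => ?_⟩, rfl, fun g hg hgf hgS => ⟨?_, ?_, ?_⟩⟩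
  · have h1 := ho' u
    have h2 := s.outdeg_le u
    have h3 := (o'.redirect e x v hi).outdeg_insert (R := s.red \ {e}) (e := f)
      (fun h => hf h.1) u
    have h4 := (o'.redirect e x v hi).outdeg_insert (R := s.red \ {e}) (e := e)
      (fun h => h.2 rfl) u
    rw [Set.insert_sdiff_singleton, Set.insert_eq_of_mem he,
      Orientation.redirect_tail_self,
      Orientation.outdeg_congr (o := o') fun g hg =>
        o'.redirect_tail_of_ne hi fun h => hg (h ▸ he)] at h4
    rw [o'.redirect_tail_of_ne hi hfe, (hoe f (Or.inr (hfz ▸ hz))).1, hfz] at h3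
    omega
  · rintro (h | h)
    · exact hgf h
    · exact hg h.1
  · rw [Orientation.redirect_tail_of_ne _ _ (ne_of_mem_of_not_mem he hg).symm]
    exact (hoe g (Or.inr hgS)).1
  · rw [Orientation.redirect_head_of_ne _ _ (ne_of_mem_of_not_mem he hg).symm]
    exact (hoe g (Or.inr hgS)).2

/-- The variant of `exists_exchange` for a vertex `z` of blue out-degree less than `k`, which
can take one more blue arc. -/
lemma exists_exchange_of_outdeg_lt [Finite V] [Finite E] (s : State inc k) {e : E} {x v z : V}
    {S : Set V} (he : e ∈ s.red) (hi : inc e = s(x, v))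
    (hS : Relation.ReflTransGen (s.o.Step s.red S) x z)
    (hz : s.o.outdeg s.red z < k) :
    ∃ s' : State inc k, s'.red = s.red \ {e} ∧
      ∀ g, g ∉ s.red → s.o.tail g ∉ S →
        g ∉ s'.red ∧ s'.o.tail g = s.o.tail g ∧ s'.o.head g = s.o.head g := by
  classical
  obtain ⟨o', ho', hoe⟩ := s.o.exists_reverse s.red S hS
  refine ⟨⟨_, o'.redirect e x v hi, s.forest.mono Set.sdiff_subset, fun u => ?_⟩, rfl,
    fun g hg hgS => ⟨?_, ?_, ?_⟩⟩
  · have h1 := ho' u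
    have h2 := s.outdeg_le u
    have h4 := (o'.redirect e x v hi).outdeg_insert (R := s.red \ {e}) (e := e)
      (fun h => h.2 rfl) u
    rw [Set.insert_sdiff_singleton, Set.insert_eq_of_mem he,
      Orientation.redirect_tail_self,
      Orientation.outdeg_congr (o := o') fun g hg =>
        o'.redirect_tail_of_ne hi fun h => hg (h ▸ he)] at h4
    by_cases huz : u = z
    · subst huz
      simp only [if_true] at h1
      omega
    · simp only [huz, if_false] at h1
      omega
  · exact fun h => hg h.1
  · rw [Orientation.redirect_tail_of_ne _ _ (ne_of_mem_of_not_mem he hg).symm]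
    exact (hoe g (Or.inr hgS)).1
  · rw [Orientation.redirect_head_of_ne _ _ (ne_of_mem_of_not_mem he hg).symm]
    exact (hoe g (Or.inr hgS)).2

end State

section Initial

variable {inc : E → Sym2 V} {k : ℕ}

/-- A red arc leads from `a` to `b`. -/
def RedStep (o : Orientation inc) (R : Set E) (b a : V) : Prop :=
  ∃ e ∈ R, o.tail e = a ∧ o.head e = b

/-- If every vertex has at most one outgoing red arc and following these arcs always ends, then
the red edges form a forest: the vertices from which the arc `e` is passed form a set that no
other red edge leaves. -/
lemma isForest_of_wellFounded {o : Orientation inc} {R : Set E}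
    (hR : ∀ e ∈ R, ∀ f ∈ R, o.tail e = o.tail f → e = f) (hwf : WellFounded (RedStep o R)) :
    IsForest inc R := by
  intro e he a b hi hr
  have key : ∀ c d, (edgeGraph inc (R \ {e})).Reachable c d →
      Relation.ReflTransGen (RedStep o R) (o.tail e) c →
      Relation.ReflTransGen (RedStep o R) (o.tail e) d := by
    rintro c d ⟨p⟩
    induction p with
    | nil => exact id
    | @cons c c' d hadj p ih =>
      intro hc
      refine ih ?_
      obtain ⟨-, f, ⟨hfR, hfe⟩, hf⟩ := hadj
      rw [o.inc_eq, Sym2.eq_iff] at hf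
      rcases hf with ⟨h1, h2⟩ | ⟨h1, h2⟩
      · rcases hc.cases_tail with h3 | ⟨c'', h3, g, hg, h4, h5⟩
        · exact absurd (hR f hfR e he (h1.trans h3)) hfe
        · have := hR f hfR g hg (h1.trans h4.symm)
          subst this
          rw [← h2, h5]
          exact h3
      · exact hc.tail ⟨f, hfR, h1, h2⟩
  have h1 : Relation.ReflTransGen (RedStep o R) (o.tail e) (o.head e) := by
    rw [o.inc_eq, Sym2.eq_iff] at hi
    rcases hi with ⟨h1, h2⟩ | ⟨h1, h2⟩
    · exact h2 ▸ key a b hr (h1 ▸ .refl)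
    · exact h2 ▸ key b a hr.symm (h1 ▸ .refl)
  have h2 : Relation.TransGen (RedStep o R) (o.tail e) (o.tail e) :=
    Relation.TransGen.tail' h1 ⟨e, he, rfl, rfl⟩
  exact hwf.transGen.irrefl.irrefl _ h2

variable [Fintype E]

open scoped Classical in
/-- The edges with both ends in `X`. -/
noncomputable def edgesIn (inc : E → Sym2 V) (X : Finset V) : Finset E :=
  Finset.univ.filter fun e => ∀ v ∈ inc e, v ∈ X

lemma mem_edgesIn {X : Finset V} {e : E} : e ∈ edgesIn inc X ↔ ∀ v ∈ inc e, v ∈ X := by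
  simp [edgesIn]

lemma Orientation.mem_edgesIn (o : Orientation inc) {X : Finset V} {e : E} :
    e ∈ edgesIn inc X ↔ o.tail e ∈ X ∧ o.head e ∈ X := by
  rw [PseudoforestDecomposition.mem_edgesIn, o.inc_eq]; simp

/-- By Hall's theorem, a multigraph in which every vertex set `X` spans at most `(k + 1) * |X|`
edges can be oriented such that the edges leaving a vertex get different colours from
`Fin (k + 1)`. -/
lemma exists_orientation [Fintype V] (h : ∀ X : Finset V, (edgesIn inc X).card ≤ (k + 1) * X.card) :
    ∃ (o : Orientation inc) (c : E → Fin (k + 1)),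
      ∀ e f, o.tail e = o.tail f → c e = c f → e = f := by
  classical
  let slots : E → Finset (V × Fin (k + 1)) := fun e => Finset.univ.filter fun p => p.1 ∈ inc e
  have hall : ∀ S : Finset E, S.card ≤ (S.biUnion slots).card := by
    intro S
    let X : Finset V := Finset.univ.filter fun v => ∃ e ∈ S, v ∈ inc e
    have h1 : S ⊆ edgesIn inc X := fun e he =>
      mem_edgesIn.2 fun v hv => by simpa [X] using ⟨e, he, hv⟩
    have h2 : S.biUnion slots = X ×ˢ Finset.univ := by
      ext p
      simp [slots, X]
    rw [h2, Finset.card_product, Finset.card_univ, Fintype.card_fin, mul_comm]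
    exact (Finset.card_le_card h1).trans (h X)
  obtain ⟨f, hf, hfs⟩ := (Finset.all_card_le_biUnion_card_iff_exists_injective slots).1 hall
  have hmem : ∀ e, (f e).1 ∈ inc e := fun e => by simpa [slots] using hfs e
  refine ⟨⟨fun e => (f e).1, fun e => Sym2.Mem.other (hmem e), fun e =>
    (Sym2.other_spec (hmem e)).symm⟩, fun e => (f e).2, fun e e' h1 h2 => hf (Prod.ext h1 h2)⟩

/-- If every nonempty vertex set `X` spans fewer than `(k + 1) * |X|` edges, then a state exists.
Starting from an orientation with one outgoing red arc at most at each vertex, the set of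
vertices from which the red arcs lead to a vertex without outgoing red arc is maximised. At a
vertex outside of this set the red arc can be exchanged for a blue arc that leads into the set. -/
theorem exists_state [Fintype V]
    (h : ∀ X : Finset V, X.Nonempty → (edgesIn inc X).card < (k + 1) * X.card) :
    Nonempty (State inc k) := by
  classical
  let P : Orientation inc × Set E → Prop := fun p =>
    (∀ v, p.1.outdeg p.2 v ≤ k) ∧ ∀ e ∈ p.2, ∀ f ∈ p.2, p.1.tail e = p.1.tail f → e = f
  have hE : edgesIn inc (∅ : Finset V) = ∅ := by
    ext e
    simp only [mem_edgesIn, Finset.notMem_empty, iff_false, not_forall]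
    exact ⟨_, Sym2.out_fst_mem (inc e), id⟩
  obtain ⟨o₀, c, hc⟩ := exists_orientation (inc := inc) (k := k) fun X => by
    rcases X.eq_empty_or_nonempty with rfl | hX
    · simp [hE]
    · exact (h X hX).le
  have h₀ : P (o₀, {e | c e = 0}) := by
    refine ⟨fun v => ?_, fun e he f hf hef => hc e f hef (he.trans hf.symm)⟩
    have h1 : {e | e ∉ {e | c e = 0} ∧ o₀.tail e = v}.ncard ≤
        ((Finset.univ.erase (0 : Fin (k + 1)) : Finset _) : Set (Fin (k + 1))).ncard := by
      refine Set.ncard_le_ncard_of_injOn c ?_ ?_ (Finset.finite_toSet _)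
      · rintro e ⟨he, -⟩
        simpa using he
      · rintro e ⟨-, he⟩ f ⟨-, hf⟩ hef
        exact hc e f (he.trans hf.symm) hef
    rwa [Set.ncard_coe_finset, Finset.card_erase_of_mem (Finset.mem_univ _), Finset.card_univ,
      Fintype.card_fin] at h1
  let T : Orientation inc × Set E → Set V := fun p => {u | Acc (RedStep p.1 p.2) u}
  let m : {p // P p} → ℕ := fun p => (T p.1)ᶜ.ncard
  have : Nonempty {p // P p} := ⟨⟨_, h₀⟩⟩
  obtain ⟨⟨⟨o, R⟩, hout, hred⟩, hmin⟩ : ∃ p : {p // P p}, ∀ q, m p ≤ m q :=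
    ⟨Function.argmin m, fun q => Function.argmin_le m q⟩
  -- no admissible pair has a strictly larger set of grounded vertices
  have himp : ∀ q, P q → ∀ u, u ∉ T (o, R) → u ∈ T q → T (o, R) ⊆ T q → False := by
    intro q hq u hu huq hsub
    have h1 : m ⟨(o, R), hout, hred⟩ ≤ m ⟨q, hq⟩ := hmin ⟨q, hq⟩
    have h2 : (T q)ᶜ.ncard < (T (o, R))ᶜ.ncard :=
      Set.ncard_lt_ncard ⟨Set.compl_subset_compl.2 hsub, fun h => (h hu) huq⟩
    exact absurd h1 (not_le.2 h2)
  suffices hall : ∀ u, u ∈ T (o, R) from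
    ⟨⟨R, o, isForest_of_wellFounded hred ⟨hall⟩, hout⟩⟩
  by_contra! hne
  let U : Finset V := Finset.univ.filter fun u => u ∉ T (o, R)
  have hU : ∀ u, u ∈ U ↔ u ∉ T (o, R) := fun u => by simp [U]
  -- the red arc leaving a vertex of `U`
  have hexit : ∀ u ∈ U, ∃ e ∈ R, o.tail e = u ∧ o.head e ∈ U := by
    intro u hu
    rw [hU] at hu
    by_contra! hcon
    refine hu (Acc.intro u ?_)
    rintro w ⟨e, he, het, rfl⟩
    by_contra hw
    exact hcon e he het ((hU _).2 hw)
  -- the vertices outside `U` stay grounded when only the arcs leaving `u ∈ U` change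
  have hkeep : ∀ R' : Set E, ∀ u ∈ U, (∀ g ∈ R', o.tail g ≠ u → g ∈ R) →
      T (o, R) ⊆ T (o, R') := by
    intro R' u hu hR' w hw
    have hw' : Acc (RedStep o R) w := hw
    induction hw' with
    | intro w hacc ih =>
      refine Acc.intro w ?_
      rintro w' ⟨g, hg, hgt, rfl⟩
      have hwu : o.tail g ≠ u := fun h => (hU u).1 hu (h ▸ hgt ▸ hw)
      have hstep : RedStep o R (o.head g) w := ⟨g, hR' g hg hwu, hgt, rfl⟩
      exact ih _ hstep (hacc _ hstep)
  have hdeg : ∀ u ∈ U, o.outdeg R u = k := by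
    intro u hu
    by_contra hk
    obtain ⟨e, he, het, -⟩ := hexit u hu
    have hsub := hkeep (R \ {e}) u hu fun g hg _ => hg.1
    refine himp (o, R \ {e}) ⟨fun v => ?_, fun f hf g hg => hred f hf.1 g hg.1⟩ u ((hU u).1 hu)
      ?_ hsub
    · have h1 := o.outdeg_insert (R := R \ {e}) (e := e) (fun h => h.2 rfl) v
      rw [Set.insert_sdiff_singleton, Set.insert_eq_of_mem he, het] at h1
      have h2 := hout v
      by_cases hv : v = u
      · subst hv
        simp only [if_true] at h1
        change o.outdeg (R \ {e}) v ≤ k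
        have h3 : o.outdeg R v ≤ k := h2
        omega
      · simp only [hv, if_false] at h1
        exact h1 ▸ h2
    · refine Acc.intro u ?_
      rintro w ⟨g, hg, hgt, -⟩
      exact absurd (hred g hg.1 e he (hgt.trans het.symm)) hg.2
  have hblue : ∀ f, o.tail f ∈ U → o.head f ∈ U := by
    intro f hfU
    obtain ⟨e, he, het, heU⟩ := hexit _ hfU
    by_cases hf : f ∈ R
    · rwa [hred f hf e he het.symm]
    by_contra hfh
    have hfh' : o.head f ∈ T (o, R) := by
      by_contra h1
      exact hfh ((hU _).2 h1)
    have hne : f ≠ e := fun h => hf (h ▸ he)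
    have hsub := hkeep (insert f (R \ {e})) _ hfU (by
      rintro g (rfl | hg) hgt
      · exact absurd rfl hgt
      · exact hg.1)
    refine himp (o, insert f (R \ {e})) ⟨fun v => ?_, ?_⟩ _ ((hU _).1 hfU) ?_ hsub
    · have h1 := o.outdeg_insert (R := R \ {e}) (e := e) (fun h => h.2 rfl) v
      have h2 := o.outdeg_insert (R := R \ {e}) (e := f) (fun h => hf h.1) v
      rw [Set.insert_sdiff_singleton, Set.insert_eq_of_mem he, het] at h1
      have h3 : o.outdeg R v ≤ k := hout v
      change o.outdeg (insert f (R \ {e})) v ≤ k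
      omega
    · have haux : ∀ g ∈ R \ {e}, o.tail g ≠ o.tail f := fun g hg h1 =>
        hg.2 (hred g hg.1 e he (h1.trans het.symm))
      rintro g (rfl | hg) g' (rfl | hg') hgg
      · rfl
      · exact absurd hgg.symm (haux g' hg')
      · exact absurd hgg (haux g hg)
      · exact hred g hg.1 g' hg'.1 hgg
    · refine Acc.intro _ ?_
      rintro w ⟨g, rfl | hg, hgt, rfl⟩
      · exact hsub hfh'
      · exact absurd (hred g hg.1 e he (hgt.trans het.symm)) hg.2
  have hUne : U.Nonempty := hne.imp fun u hu => (hU u).2 hu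
  have hcount : (k + 1) * U.card ≤ (edgesIn inc U).card := by
    have h1 : ∀ u ∈ U, k + 1 ≤ ((edgesIn inc U).filter fun e => o.tail e = u).card := by
      intro u hu
      obtain ⟨e, he, het, heU⟩ := hexit u hu
      rw [← Set.ncard_coe_finset, ← hdeg u hu]
      have h2 : e ∉ {f | f ∉ R ∧ o.tail f = u} := fun h => h.1 he
      rw [Orientation.outdeg, ← Set.ncard_insert_of_notMem h2]
      refine Set.ncard_le_ncard ?_ (Finset.finite_toSet _)
      rintro f (rfl | ⟨-, hf⟩)
      · simpa [o.mem_edgesIn, het] using ⟨hu, heU⟩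
      · subst hf
        simpa [o.mem_edgesIn] using ⟨hu, hblue f hu⟩
    have h2 := Finset.card_eq_sum_card_fiberwise (s := edgesIn inc U) (t := U) (f := o.tail)
      fun e he => (o.mem_edgesIn.1 he).1
    rw [h2, mul_comm]
    exact Finset.card_nsmul_le_sum U _ _ h1
  exact absurd (h U hUne) (not_lt.2 hcount)

end Initial

/-! ### Bad components and optimal explorations -/

/-- A tree with `n` vertices and diameter `D` is bad if `z = (D - 1) / 2`, the largest `z` with
`D > 2 * z`, satisfies `n - 1 ≥ d - z * (k - 1) + 1`. For `D = 0` there is no such `z`, and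
truncated subtraction gives `z = 0`; a tree with one vertex does not satisfy the inequality. -/
def IsBad (k d n D : ℕ) : Prop := d + 2 ≤ n + (k - 1) * ((D - 1) / 2)

lemma IsBad.mono {k d n n' D D' : ℕ} (h : IsBad k d n D) (hn : n ≤ n') (hD : D ≤ D') :
    IsBad k d n' D' := by
  have h1 : (k - 1) * ((D - 1) / 2) ≤ (k - 1) * ((D' - 1) / 2) :=
    Nat.mul_le_mul_left _ (Nat.div_le_div_right (Nat.sub_le_sub_right hD 1))
  unfold IsBad at *
  omega

namespace State

variable {inc : E → Sym2 V} {k d : ℕ} [Fintype V]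

/-- The red component of `u` is bad. -/
def Bad (s : State inc k) (d : ℕ) (u : V) : Prop :=
  IsBad k d (order s.graph u) (compDiam s.graph u)

lemma bad_congr {s : State inc k} {u v : V} (h : s.graph.Reachable u v) :
    s.Bad d u ↔ s.Bad d v := by
  rw [Bad, Bad, order_eq h, compDiam_eq h]

open scoped Classical in
/-- The potential that measures how far a state is from having no bad component. The base of the
powers exceeds the number of vertices, so that replacing a bad component by any number of smaller
ones decreases it. -/
noncomputable def badness (d : ℕ) (s : State inc k) : ℕ :=
  ∑ u, if s.Bad d u then (Fintype.card V + 1) ^ order s.graph u else 0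

lemma badness_le {s s' : State inc k}
    (h : ∀ u, s'.Bad d u → s.Bad d u ∧ order s'.graph u ≤ order s.graph u) :
    s'.badness d ≤ s.badness d := by
  classical
  refine Finset.sum_le_sum fun u _ => ?_
  by_cases hu : s'.Bad d u
  · rw [if_pos hu, if_pos (h u hu).1]
    exact Nat.pow_le_pow_right (by omega) (h u hu).2
  · simp [hu]

lemma badness_lt {s s' : State inc k} {c : V} (hc : s.Bad d c)
    (hn : order s'.graph c < order s.graph c)
    (h : ∀ u, s'.Bad d u → (s.Bad d u ∧ order s'.graph u ≤ order s.graph u) ∨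
      order s'.graph u < order s.graph c) :
    s'.badness d < s.badness d := by
  classical
  set B := Fintype.card V + 1 with hB
  obtain ⟨m, hm⟩ : ∃ m, order s.graph c = m + 1 := ⟨order s.graph c - 1, by omega⟩
  have hpow : ∀ u, order s'.graph u < order s.graph c → B ^ order s'.graph u ≤ B ^ m := fun u hu =>
    Nat.pow_le_pow_right (by omega) (by omega)
  have h1 : ∀ u ∈ Finset.univ.erase c,
      (if s'.Bad d u then B ^ order s'.graph u else 0) ≤
        (if s.Bad d u then B ^ order s.graph u else 0) + B ^ m := by
    intro u _
    by_cases hu : s'.Bad d u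
    · rw [if_pos hu]
      rcases h u hu with ⟨h2, h3⟩ | h2
      · rw [if_pos h2]
        exact le_add_right (Nat.pow_le_pow_right (by omega) h3)
      · exact le_add_left (hpow u h2)
    · simp [hu]
  have h2 := Finset.sum_le_sum h1
  rw [Finset.sum_add_distrib, Finset.sum_const, smul_eq_mul,
    Finset.card_erase_of_mem (Finset.mem_univ c), Finset.card_univ] at h2
  have h3 : (if s'.Bad d c then B ^ order s'.graph c else 0) ≤ B ^ m := by
    split_ifs
    · exact hpow c hn
    · exact Nat.zero_le _
  have h4 : s.badness d = B ^ (m + 1) + ∑ u ∈ Finset.univ.erase c,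
      (if s.Bad d u then B ^ order s.graph u else 0) := by
    rw [badness, ← Finset.add_sum_erase _ _ (Finset.mem_univ c), if_pos hc, hm]
  have h5 : s'.badness d = (if s'.Bad d c then B ^ order s'.graph c else 0) +
      ∑ u ∈ Finset.univ.erase c, (if s'.Bad d u then B ^ order s'.graph u else 0) := by
    rw [badness, ← Finset.add_sum_erase _ _ (Finset.mem_univ c)]
  have h6 : 0 < B ^ m := Nat.pow_pos (by omega)
  have h7 : (Fintype.card V - 1) * B ^ m + B ^ m + B ^ m ≤ B ^ (m + 1) := by
    have : 0 < Fintype.card V := Fintype.card_pos_iff.2 ⟨c⟩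
    obtain ⟨M, hM⟩ : ∃ M, Fintype.card V = M + 1 := ⟨Fintype.card V - 1, by omega⟩
    rw [pow_succ, hB, hM]
    simp only [Nat.add_sub_cancel]
    exact le_of_eq (by ring)
  omega

/-- An exploration of a state: representatives `w 0, …, w (N - 1)` of different red components,
the first of them bad, such that every other representative is the head of a blue arc that leaves
an earlier component. -/
structure IsExploration (s : State inc k) (d N : ℕ) (w : ℕ → V) : Prop where
  pos : 0 < N
  bad : s.Bad d (w 0)
  distinct : ∀ i < N, ∀ j < i, ¬ s.graph.Reachable (w j) (w i)
  arc : ∀ i < N, 0 < i → ∃ j < i, ∃ e ∉ s.red,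
    s.graph.Reachable (w j) (s.o.tail e) ∧ s.o.head e = w i

lemma IsExploration.le_card {s : State inc k} {N : ℕ} {w : ℕ → V} (h : s.IsExploration d N w) :
    N ≤ Fintype.card V := by
  rw [← Finset.card_range N]
  refine Finset.card_le_card_of_injOn w (fun _ _ => Finset.mem_univ _) ?_
  intro i hi j hj hij
  simp only [Finset.coe_range, Set.mem_Iio] at hi hj
  rcases lt_trichotomy i j with h1 | h1 | h1
  · exact absurd (hij ▸ .rfl) (h.distinct j hj i h1)
  · exact h1
  · exact absurd (hij ▸ .rfl) (h.distinct i hi j h1)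

open scoped Classical in
/-- The sequence of component orders of an exploration. Beyond the end of the exploration it
exceeds all orders, so that prolonging an exploration makes the sequence lexicographically
smaller. -/
noncomputable def orders (s : State inc k) (N : ℕ) (w : ℕ → V) (i : Fin (Fintype.card V)) : ℕ :=
  if i < N then order s.graph (w i) else Fintype.card V + 1

/-- A state of minimal badness with an exploration whose sequence of component orders is
lexicographically minimal among all such states. -/
structure IsOptimal (s : State inc k) (d N : ℕ) (w : ℕ → V) : Prop
    extends s.IsExploration d N w where
  badness_le : ∀ s' : State inc k, s.badness d ≤ s'.badness d
  orders_le : ∀ (s' : State inc k) (N' : ℕ) (w' : ℕ → V), s'.badness d ≤ s.badness d →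
    s'.IsExploration d N' w' → ¬ toLex (s'.orders N' w') < toLex (s.orders N w)

lemma exists_isOptimal [Nonempty (State inc k)] (h : ∀ s : State inc k, ∃ u, s.Bad d u) :
    ∃ (s : State inc k) (N : ℕ) (w : ℕ → V), s.IsOptimal d N w := by
  let s₀ : State inc k := Function.argmin (badness d)
  have hs₀ : ∀ s' : State inc k, s₀.badness d ≤ s'.badness d := fun s' =>
    Function.argmin_le (badness d) s'
  let A : Set (State inc k × ℕ × (ℕ → V)) :=
    {p | p.1.badness d ≤ s₀.badness d ∧ p.1.IsExploration d p.2.1 p.2.2}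
  let key : State inc k × ℕ × (ℕ → V) → Lex (Fin (Fintype.card V) → ℕ) :=
    fun p => toLex (p.1.orders p.2.1 p.2.2)
  have hA : A.Nonempty := by
    obtain ⟨u, hu⟩ := h s₀
    have he : s₀.IsExploration d 1 fun _ => u :=
      ⟨one_pos, hu, fun i hi j hj => by omega, fun i hi hi' => by omega⟩
    exact ⟨(s₀, 1, fun _ => u), le_rfl, he⟩
  obtain ⟨p, hpA, hp⟩ := (InvImage.wf key wellFounded_lt).has_min A hA
  refine ⟨p.1, p.2.1, p.2.2, hpA.2, fun s' => hpA.1.trans (hs₀ s'), fun s' N' w' hb he hlt => ?_⟩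
  exact hp (s', N', w') ⟨hb.trans hpA.1, he⟩ hlt

namespace IsOptimal

variable {s : State inc k} {N : ℕ} {w : ℕ → V}

/-- An exchange that leaves the components before `w i` alone and shrinks the component of `w i`
contradicts optimality, provided that it creates no bad components, except for pieces of a bad
component of `w i`. -/
lemma no_improvement (h : s.IsOptimal d N w) {i : ℕ} (hi : i < N) (s' : State inc k)
    (hadj : ∀ j < i, ∀ a, s.graph.Reachable (w j) a → ∀ b, s.graph.Adj a b ↔ s'.graph.Adj a b)
    (harc : ∀ j < i, ∀ e ∉ s.red, s.graph.Reachable (w j) (s.o.tail e) →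
      e ∉ s'.red ∧ s'.o.tail e = s.o.tail e ∧ s'.o.head e = s.o.head e)
    (hn : order s'.graph (w i) < order s.graph (w i))
    (hb : ∀ u, s'.Bad d u → (s.Bad d u ∧ order s'.graph u ≤ order s.graph u) ∨
      (s.Bad d (w i) ∧ order s'.graph u < order s.graph (w i))) : False := by
  by_cases hbad : s.Bad d (w i)
  · have h1 := badness_lt hbad hn fun u hu => (hb u hu).imp_right fun h2 => h2.2
    exact absurd (h.badness_le s') (not_le.2 h1)
  have h1 : s'.badness d ≤ s.badness d :=
    State.badness_le fun u hu => (hb u hu).resolve_right fun h2 => hbad h2.1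
  have hi0 : 0 < i := Nat.pos_of_ne_zero fun h0 => hbad (h0 ▸ h.bad)
  have hex : s'.IsExploration d (i + 1) w := by
    refine ⟨by omega, ?_, fun a ha b hb => ?_, fun a ha ha0 => ?_⟩
    · have h2 := h.bad
      rwa [Bad, ← order_congr (hadj 0 hi0), ← compDiam_congr (hadj 0 hi0)] at h2
    · rw [reachable_congr (hadj b (by omega))]
      exact h.distinct a (by omega) b hb
    · obtain ⟨j, hj, e, he, het, heh⟩ := h.arc a (by omega) ha0
      obtain ⟨h2, h3, h4⟩ := harc j (by omega) e he het
      refine ⟨j, hj, e, h2, ?_, h4.trans heh⟩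
      rw [h3, reachable_congr (hadj j (by omega))]
      exact het
  refine h.orders_le s' (i + 1) w h1 hex ⟨⟨i, hi.trans_le h.le_card⟩, fun j hj => ?_, ?_⟩
  · have hj' : (j : ℕ) < i := hj
    change s'.orders (i + 1) w j = s.orders N w j
    rw [orders, orders, if_pos (by omega), if_pos (by omega), order_congr (hadj j hj')]
  · change s'.orders (i + 1) w _ < s.orders N w _
    rw [orders, orders, if_pos (by simp), if_pos (by simpa using hi)]
    exact hn

/-- An optimal exploration cannot be prolonged. -/
lemma exists_reachable_head (h : s.IsOptimal d N w) {j : ℕ} (hj : j < N) {e : E} (he : e ∉ s.red)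
    (het : s.graph.Reachable (w j) (s.o.tail e)) :
    ∃ t < N, s.graph.Reachable (w t) (s.o.head e) := by
  by_contra! hcon
  let w' : ℕ → V := fun i => if i < N then w i else s.o.head e
  have hw : ∀ i < N, w' i = w i := fun i hi => if_pos hi
  have hwN : w' N = s.o.head e := if_neg (lt_irrefl N)
  have hex : s.IsExploration d (N + 1) w' := by
    refine ⟨by omega, ?_, fun a ha b hb => ?_, fun a ha ha0 => ?_⟩
    · rw [hw 0 h.pos]
      exact h.bad
    · rw [hw b (by omega)]
      rcases Nat.lt_succ_iff_lt_or_eq.1 ha with h1 | rfl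
      · rw [hw a h1]
        exact h.distinct a h1 b hb
      · rw [hwN]
        exact hcon b hb
    · rcases Nat.lt_succ_iff_lt_or_eq.1 ha with h1 | rfl
      · obtain ⟨i, hi, f, hf⟩ := h.arc a h1 ha0
        refine ⟨i, hi, f, ?_⟩
        rw [hw i (by omega), hw a h1]
        exact hf
      · exact ⟨j, hj, e, he, by rwa [hw j hj], hwN.symm⟩
  refine h.orders_le s (N + 1) w' le_rfl hex ⟨⟨N, hex.le_card⟩, fun i hi => ?_, ?_⟩
  · have hi' : (i : ℕ) < N := hi
    change s.orders (N + 1) w' i = s.orders N w i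
    rw [orders, orders, if_pos (by omega), if_pos hi', hw i hi']
  · change s.orders (N + 1) w' _ < s.orders N w _
    rw [orders, orders, if_pos (by simp), if_neg (by simp)]
    exact Nat.lt_succ_of_le (order_le_card _ _)

end IsOptimal

end State

/-! ### Exchanges that optimality rules out -/

/-- Two graphs that arise from `G₀` by adding an edge look the same around the vertices that are
not connected to the ends of these edges. -/
lemma Joins.adj_congr {G₀ G G' : SimpleGraph V} {x v p q u : V} (h : Joins G₀ G x v)
    (h' : Joins G₀ G' p q) (hx : ¬ G.Reachable u x) (hp : ¬ G.Reachable u p)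
    (hq : ¬ G.Reachable u q) : ∀ a, G.Reachable u a → ∀ b, G.Adj a b ↔ G'.Adj a b := by
  intro a ha b
  rw [h.adj_iff, h'.adj_iff]
  have hax : a ≠ x := fun h1 => hx (h1 ▸ ha)
  have hav : a ≠ v := fun h1 => hx ((h1 ▸ ha).trans h.adj.reachable.symm)
  have hap : a ≠ p := fun h1 => hp (h1 ▸ ha)
  have haq : a ≠ q := fun h1 => hq (h1 ▸ ha)
  simp [hax, hav, hap, haq]

namespace State.IsOptimal

variable {inc : E → Sym2 V} {k d : ℕ} [Fintype V]
variable {s : State inc k} {N : ℕ} {w : ℕ → V}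

/-- The exchange at `x`: the red edge `e = xv` becomes blue and the arc from `x` to the later
component of `w t` becomes red. It is an improvement if the new component of `w j` is smaller than
the old one, and if the new component of `x` is not bad, except as a smaller replacement of a bad
component. -/
lemma no_exchange_at [Finite E] (h : s.IsOptimal d N w) {j t : ℕ} (hj : j < N) (hjt : j < t)
    (ht : t < N)
    {x v : V} {e f : E} (hx : s.graph.Reachable (w j) x) (he : e ∈ s.red) (hi : inc e = s(x, v))
    (hf : f ∉ s.red) (hft : s.o.tail f = x) (hfh : s.o.head f = w t)
    (hw : (edgeGraph inc (s.red \ {e})).Reachable v (w j) ∨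
      order s.graph (w t) < order (edgeGraph inc (s.red \ {e})) v)
    (hbad : IsBad k d (order (edgeGraph inc (s.red \ {e})) x + order s.graph (w t))
        (max (max (compDiam (edgeGraph inc (s.red \ {e})) x) (compDiam s.graph (w t)))
          (ecc (edgeGraph inc (s.red \ {e})) x + 1 + ecc s.graph (w t))) →
      s.Bad d x ∧ order s.graph (w t) < order (edgeGraph inc (s.red \ {e})) v) : False := by
  have hJ : Joins (edgeGraph inc (s.red \ {e})) s.graph x v := s.forest.joins he hi
  set G₀ := edgeGraph inc (s.red \ {e}) with hG₀
  have hxt : ¬ s.graph.Reachable x (w t) := fun h1 => h.distinct t ht j hjt (hx.trans h1)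
  have hvt : ¬ s.graph.Reachable v (w t) := fun h1 => hxt (hJ.adj.reachable.trans h1)
  have hxt₀ : ¬ G₀.Reachable x (w t) := fun h1 => hxt (h1.mono hJ.le)
  have hvt₀ : ¬ G₀.Reachable v (w t) := fun h1 => hvt (h1.mono hJ.le)
  have hfi : inc f = s(x, w t) := by rw [s.o.inc_eq, hft, hfh]
  have hJ' : Joins G₀ (edgeGraph inc (insert f (s.red \ {e}))) x (w t) := joins_insert hfi hxt₀
  have hC : ∀ a, G₀.Reachable (w t) a → ∀ b, G₀.Adj a b ↔ s.graph.Adj a b :=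
    hJ.congr_off (fun h1 => hxt₀ h1.symm) (fun h1 => hvt₀ h1.symm)
  obtain ⟨s', hs', hs'e⟩ := s.exists_exchange he hi (S := ∅) .refl (Set.notMem_empty x) hf hft
    ((s.forest.mono Set.sdiff_subset).insert_edge hfi hxt₀)
  have hG' : s'.graph = edgeGraph inc (insert f (s.red \ {e})) := by rw [graph, hs']
  rw [← hG'] at hJ'
  have hoff : ∀ u, ¬ s.graph.Reachable u x → ¬ s.graph.Reachable u (w t) →
      ∀ a, s.graph.Reachable u a → ∀ b, s.graph.Adj a b ↔ s'.graph.Adj a b :=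
    fun u h1 h2 => hJ.adj_congr hJ' h1 h1 h2
  have hv : ∀ a, G₀.Reachable v a → ∀ b, G₀.Adj a b ↔ s'.graph.Adj a b :=
    hJ'.congr_off (fun h1 => hJ.not_reachable h1.symm) hvt₀
  have hnx : order s'.graph x = order G₀ x + order s.graph (w t) := by
    rw [hJ'.order_add, ← order_congr hC]
  have hDx : compDiam s'.graph x = max (max (compDiam G₀ x) (compDiam s.graph (w t)))
      (ecc G₀ x + 1 + ecc s.graph (w t)) := by
    rw [hJ'.compDiam_left, ← compDiam_congr hC, ← ecc_congr hC]
  have hnK := hJ.order_add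
  have hnj : order s.graph (w j) = order s.graph x := order_eq hx
  have hposx := order_pos G₀ x
  refine h.no_improvement hj s' (fun i hi' => ?_) (fun i hi' g hg hgt => ?_) ?_ (fun u hu => ?_)
  · exact hoff _ (fun h1 => h.distinct j hj i hi' (h1.trans hx.symm))
      (h.distinct t ht i (by omega))
  · refine hs'e g hg ?_ (Set.notMem_empty _)
    rintro rfl
    exact h.distinct j hj i hi' (hgt.trans (hft ▸ hx.symm))
  · rcases hJ.reachable_left_iff.1 hx.symm with h1 | h1
    · rw [← order_eq (h1.mono hJ'.le), hnx]
      rcases hw with h2 | h2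
      · exact absurd (h1.trans h2.symm) hJ.not_reachable
      · omega
    · rw [← order_eq (h1.mono hJ'.le), order_congr hv]
      omega
  · by_cases h1 : s.graph.Reachable x u
    · right
      rw [bad_congr hx]
      rcases hJ.reachable_left_iff.1 h1 with h2 | h2
      · rw [← bad_congr (h2.mono hJ'.le), Bad, hnx, hDx] at hu
        rw [← order_eq (h2.mono hJ'.le), hnx]
        obtain ⟨h3, h4⟩ := hbad hu
        exact ⟨h3, by omega⟩
      · rw [← bad_congr (h2.mono hJ'.le), Bad, order_congr hv, compDiam_congr hv] at hu
        rw [← order_eq (h2.mono hJ'.le), order_congr hv]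
        refine ⟨IsBad.mono hu (by omega) ?_, by omega⟩
        rw [hJ.compDiam_left]
        exact le_max_of_le_left (le_max_right _ _)
    by_cases h2 : s.graph.Reachable (w t) u
    · right
      have h3 : s'.graph.Reachable x u :=
        hJ'.reachable_left_iff.2 (Or.inr ((reachable_congr hC u).1 h2))
      rw [bad_congr hx]
      rw [← bad_congr h3, Bad, hnx, hDx] at hu
      rw [← order_eq h3, hnx]
      obtain ⟨h3, h4⟩ := hbad hu
      exact ⟨h3, by omega⟩
    · left
      have h3 := hoff u (fun h => h1 h.symm) (fun h => h2 h.symm)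
      rw [Bad, order_congr h3, compDiam_congr h3] at hu
      exact ⟨hu, (order_congr h3).le⟩

/-- Following the exploration backwards from `w j` through components that are single vertices, one
reaches a component with an edge. -/
lemma exists_source (h : s.IsOptimal d N w) (hroot : 2 ≤ order s.graph (w 0)) {j : ℕ}
    (hj : j < N) (hj0 : 0 < j) : ∃ i < j, ∃ x, s.graph.Reachable (w i) x ∧ 2 ≤ order s.graph x ∧
      Relation.ReflTransGen
        (s.o.Step s.red {a | ∃ t, i ≤ t ∧ t < j ∧ s.graph.Reachable (w t) a}) x (w j) := by
  induction j using Nat.strong_induction_on with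
  | _ j ih =>
    obtain ⟨i, hij, e, he, het, heh⟩ := h.arc j hj hj0
    by_cases hn : 2 ≤ order s.graph (w i)
    · exact ⟨i, hij, s.o.tail e, het, order_eq het ▸ hn,
        .single ⟨⟨i, le_rfl, hij, het⟩, e, he, rfl, heh⟩⟩
    · have hi0 : 0 < i := Nat.pos_of_ne_zero fun h0 => hn (h0 ▸ hroot)
      obtain ⟨i', hi', x, hx, hnx, hpath⟩ := ih i hij (by omega) hi0
      refine ⟨i', by omega, x, hx, hnx, ?_⟩
      have hti : s.o.tail e = w i := eq_of_order_le_one (by omega) het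
      have hsub : {a | ∃ t, i' ≤ t ∧ t < i ∧ s.graph.Reachable (w t) a} ⊆
          {a | ∃ t, i' ≤ t ∧ t < j ∧ s.graph.Reachable (w t) a} := by
        rintro a ⟨t, h1, h2, h3⟩
        exact ⟨t, h1, by omega, h3⟩
      exact .tail (Relation.ReflTransGen.mono (fun a b hab => hab.mono hsub) _ _ hpath)
        ⟨⟨i, hi'.le, hij, .rfl⟩, e, he, hti, heh⟩

/-- No vertex of blue out-degree less than `k` can be reached from an explored component with an
edge. -/
lemma no_deficient_path [Finite E] (h : s.IsOptimal d N w) {i : ℕ} (hi : i < N) {x z : V}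
    {S : Set V} (hx : s.graph.Reachable (w i) x) (hnx : 2 ≤ order s.graph x)
    (hS : ∀ a ∈ S, ∀ t < i, ¬ s.graph.Reachable (w t) a)
    (hpath : Relation.ReflTransGen (s.o.Step s.red S) x z) (hz : s.o.outdeg s.red z < k) :
    False := by
  obtain ⟨u, hxu, hne⟩ := exists_reachable_ne hnx
  obtain ⟨e, he, v, hi', -⟩ := s.forest.exists_cut hxu hne.symm
  have hJ : Joins (edgeGraph inc (s.red \ {e})) s.graph x v := s.forest.joins he hi'
  obtain ⟨s', hs', hs'e⟩ := s.exists_exchange_of_outdeg_lt he hi' hpath hz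
  have hG' : s'.graph = edgeGraph inc (s.red \ {e}) := by rw [graph, hs']
  rw [← hG'] at hJ
  have hoff : ∀ u, ¬ s.graph.Reachable x u →
      ∀ a, s.graph.Reachable u a → ∀ b, s.graph.Adj a b ↔ s'.graph.Adj a b := by
    intro u hu a ha b
    have hu' : ¬ s.graph.Reachable u x := fun h1 => hu h1.symm
    have hv' : ¬ s.graph.Reachable u v := fun h1 => hu' (h1.trans hJ.adj.reachable.symm)
    have h2 := hJ.congr_off (fun h1 => hu' (h1.mono hJ.le)) (fun h1 => hv' (h1.mono hJ.le))
    exact (h2 a ((reachable_congr h2 a).1 ha) b).symm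
  have hpiece : ∀ u, s.graph.Reachable x u → order s'.graph u < order s.graph x ∧
      compDiam s'.graph u ≤ compDiam s.graph x := by
    intro u hu
    have h1 := hJ.order_add
    have h2 := hJ.compDiam_left
    have h3 := order_pos s'.graph x
    have h4 := order_pos s'.graph v
    rcases hJ.reachable_left_iff.1 hu with h5 | h5 <;>
      · rw [← order_eq h5, ← compDiam_eq h5]
        omega
  have hnj : order s.graph (w i) = order s.graph x := order_eq hx
  refine h.no_improvement hi s' (fun t ht => ?_) (fun t ht g hg hgt => ?_) ?_ (fun u hu => ?_)
  · exact hoff _ fun h1 => h.distinct i hi t ht (h1.symm.trans hx.symm)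
  · exact hs'e g hg fun h1 => hS _ h1 t ht hgt
  · rw [hnj]
    exact (hpiece _ hx.symm).1
  · by_cases h1 : s.graph.Reachable x u
    · obtain ⟨h2, h3⟩ := hpiece u h1
      rw [bad_congr hx, hnj]
      exact Or.inr ⟨IsBad.mono hu h2.le h3, h2⟩
    · have h3 := hoff u h1
      rw [Bad, order_congr h3, compDiam_congr h3] at hu
      exact Or.inl ⟨hu, (order_congr h3).le⟩

/-- Merging the component of `w j` with a later component, by reversing a blue path that ends
in `w j`, is an improvement unless the merged component is bad. -/
lemma isBad_merge [Finite E] (h : s.IsOptimal d N w) (hroot : 2 ≤ order s.graph (w 0)) {j t : ℕ}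
    (hj0 : 0 < j) (hj : j < N) (hjt : j < t) (ht : t < N) {f : E}
    (hf : f ∉ s.red) (hft : s.o.tail f = w j) (hfh : s.o.head f = w t) :
    IsBad k d (order s.graph (w j) + order s.graph (w t))
      (max (max (compDiam s.graph (w j)) (compDiam s.graph (w t)))
        (ecc s.graph (w j) + 1 + ecc s.graph (w t))) := by
  by_contra hbad
  obtain ⟨i, hij, x, hx, hnx, hpath⟩ := h.exists_source hroot hj hj0
  have hi : i < N := by omega
  obtain ⟨u, hxu, hne⟩ := exists_reachable_ne hnx
  obtain ⟨e, he, v, hi', -⟩ := s.forest.exists_cut hxu hne.symm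
  have hJ : Joins (edgeGraph inc (s.red \ {e})) s.graph x v := s.forest.joins he hi'
  set G₀ := edgeGraph inc (s.red \ {e}) with hG₀
  have hjt' : ¬ s.graph.Reachable (w j) (w t) := h.distinct t ht j hjt
  have hxj : ¬ s.graph.Reachable x (w j) := fun h1 => h.distinct j hj i hij (hx.trans h1)
  have hxt : ¬ s.graph.Reachable x (w t) := fun h1 => h.distinct t ht i (by omega) (hx.trans h1)
  have hfi : inc f = s(w j, w t) := by rw [s.o.inc_eq, hft, hfh]
  have hjt₀ : ¬ G₀.Reachable (w j) (w t) := fun h1 => hjt' (h1.mono hJ.le)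
  have hJ' : Joins G₀ (edgeGraph inc (insert f (s.red \ {e}))) (w j) (w t) := joins_insert hfi hjt₀
  have hzS : w j ∉ {a | ∃ t, i ≤ t ∧ t < j ∧ s.graph.Reachable (w t) a} := by
    rintro ⟨t', -, h2, h3⟩
    exact h.distinct j hj t' h2 h3
  obtain ⟨s', hs', hs'e⟩ := s.exists_exchange he hi' hpath hzS hf hft
    ((s.forest.mono Set.sdiff_subset).insert_edge hfi hjt₀)
  have hG' : s'.graph = edgeGraph inc (insert f (s.red \ {e})) := by rw [graph, hs']
  rw [← hG'] at hJ'
  have hoff₀ : ∀ u, ¬ s.graph.Reachable x u →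
      ∀ a, G₀.Reachable u a → ∀ b, G₀.Adj a b ↔ s.graph.Adj a b := by
    intro u hu
    have hu' : ¬ s.graph.Reachable u x := fun h1 => hu h1.symm
    have hv' : ¬ s.graph.Reachable u v := fun h1 => hu' (h1.trans hJ.adj.reachable.symm)
    exact hJ.congr_off (fun h1 => hu' (h1.mono hJ.le)) (fun h1 => hv' (h1.mono hJ.le))
  have hCj := hoff₀ _ hxj
  have hCt := hoff₀ _ hxt
  have hoff : ∀ u, ¬ s.graph.Reachable u x → ¬ s.graph.Reachable u (w j) →
      ¬ s.graph.Reachable u (w t) →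
      ∀ a, s.graph.Reachable u a → ∀ b, s.graph.Adj a b ↔ s'.graph.Adj a b :=
    fun u h1 h2 h3 => hJ.adj_congr hJ' h1 h2 h3
  have hgood : ∀ u, s'.graph.Reachable (w j) u → ¬ s'.Bad d u := by
    intro u hu
    rw [← bad_congr hu, Bad, hJ'.order_add, hJ'.compDiam_left, ← order_congr hCj,
      ← order_congr hCt, ← compDiam_congr hCj, ← compDiam_congr hCt, ← ecc_congr hCj,
      ← ecc_congr hCt]
    exact hbad
  have hpiece : ∀ u, s.graph.Reachable x u → order s'.graph u < order s.graph x ∧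
      compDiam s'.graph u ≤ compDiam s.graph x := by
    intro u hu
    have h1 := hJ.order_add
    have h2 := hJ.compDiam_left
    have h3 := order_pos G₀ x
    have h4 := order_pos G₀ v
    have h6 : ∀ a, G₀.Reachable u a → ∀ b, G₀.Adj a b ↔ s'.graph.Adj a b :=
      hJ'.congr_off (fun h1 => hxj (hu.trans (h1.mono hJ.le)))
        (fun h1 => hxt (hu.trans (h1.mono hJ.le)))
    rw [order_congr h6, compDiam_congr h6]
    rcases hJ.reachable_left_iff.1 hu with h5 | h5 <;>
      · rw [← order_eq h5, ← compDiam_eq h5]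
        omega
  have hnj : order s.graph (w i) = order s.graph x := order_eq hx
  refine h.no_improvement hi s' (fun t' ht' => ?_) (fun t' ht' g hg hgt => ?_) ?_ (fun u hu => ?_)
  · exact hoff _ (fun h1 => h.distinct i hi t' ht' (h1.trans hx.symm))
      (h.distinct j hj t' (by omega)) (h.distinct t ht t' (by omega))
  · refine hs'e g hg ?_ ?_
    · rintro rfl
      exact h.distinct j hj t' (by omega) (hft ▸ hgt)
    · rintro ⟨t'', h1, h2, h3⟩
      exact h.distinct t'' (by omega) t' (by omega) (hgt.trans h3.symm)
  · rw [hnj]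
    exact (hpiece _ hx.symm).1
  · by_cases h1 : s.graph.Reachable x u
    · obtain ⟨h2, h3⟩ := hpiece u h1
      rw [bad_congr hx, hnj]
      exact Or.inr ⟨IsBad.mono hu h2.le h3, h2⟩
    by_cases h2 : s.graph.Reachable (w j) u
    · exact absurd hu
        (hgood u (hJ'.reachable_left_iff.2 (Or.inl ((reachable_congr hCj u).1 h2))))
    by_cases h3 : s.graph.Reachable (w t) u
    · exact absurd hu
        (hgood u (hJ'.reachable_left_iff.2 (Or.inr ((reachable_congr hCt u).1 h3))))
    · have h4 := hoff u (fun h => h1 h.symm) (fun h => h2 h.symm) (fun h => h3 h.symm)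
      rw [Bad, order_congr h4, compDiam_congr h4] at hu
      exact Or.inl ⟨hu, (order_congr h4).le⟩

end State.IsOptimal

/-! ### Small components in an optimal exploration -/

/-- A tree with at most `2 * (ℓ + 1)` vertices, such as the union of two small trees, is not bad. -/
lemma not_isBad_of_small {k d ℓ n D : ℕ} (hk : 1 ≤ k) (hℓ : (k + 1) * ℓ < d) (hn : n ≤ 2 * ℓ + 2)
    (hD : (D - 1) / 2 ≤ ℓ) : ¬ IsBad k d n D := by
  obtain ⟨k, rfl⟩ := Nat.exists_eq_add_of_le' hk
  have h1 : k * ((D - 1) / 2) ≤ k * ℓ := Nat.mul_le_mul_left k hD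
  have h2 : (k + 1 + 1) * ℓ = k * ℓ + 2 * ℓ := by ring
  unfold IsBad
  simp only [Nat.add_sub_cancel]
  omega

/-- A tree that becomes bad by adding a small tree is not small itself. -/
lemma le_of_isBad_add {k d ℓ n c D : ℕ} (hk : 1 ≤ k) (hℓ : (k + 1) * ℓ < d)
    (h : IsBad k d (n + c) D) (hD : (D - 1) / 2 ≤ ℓ) (hc : c ≤ ℓ + 1) : ℓ + 2 ≤ n := by
  obtain ⟨k, rfl⟩ := Nat.exists_eq_add_of_le' hk
  have h1 : k * ((D - 1) / 2) ≤ k * ℓ := Nat.mul_le_mul_left k hD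
  have h2 : (k + 1 + 1) * ℓ = k * ℓ + 2 * ℓ := by ring
  unfold IsBad at h
  simp only [Nat.add_sub_cancel] at h
  omega

/-- If two disjoint parts of a tree both become bad by adding small trees, and the diameters do not
grow too much, then the whole tree is bad. -/
lemma isBad_of_isBad_add_of_isBad_add {k d ℓ n n₁ n₂ c₁ c₂ D D₁ D₂ : ℕ} (hk : 1 ≤ k)
    (hℓ : (k + 1) * ℓ < d) (h₁ : IsBad k d (n₁ + c₁) D₁) (h₂ : IsBad k d (n₂ + c₂) D₂)
    (hn : n₁ + n₂ ≤ n) (hc₁ : c₁ ≤ ℓ + 1) (hc₂ : c₂ ≤ ℓ + 1)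
    (hD : (D₁ - 1) / 2 + (D₂ - 1) / 2 ≤ (D - 1) / 2 + ℓ) : IsBad k d n D := by
  obtain ⟨k, rfl⟩ := Nat.exists_eq_add_of_le' hk
  have h1 := Nat.mul_le_mul_left k hD
  rw [mul_add, mul_add] at h1
  have h2 : (k + 1 + 1) * ℓ = k * ℓ + 2 * ℓ := by ring
  unfold IsBad at *
  simp only [Nat.add_sub_cancel] at *
  omega

/-- The diameter of the tree obtained from trees with diameters `D`, `D'` by an edge between
vertices of eccentricities `h`, `h'`. -/
def joinDiam (D D' h h' : ℕ) : ℕ := max (max D D') (h + 1 + h')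

lemma joinDiam_mono {D₁ D₂ D' h₁ h₂ h' : ℕ} (hD : D₁ ≤ D₂) (hh : h₁ ≤ h₂) :
    joinDiam D₁ D' h₁ h' ≤ joinDiam D₂ D' h₂ h' := by
  unfold joinDiam; omega

lemma joinDiam_le {D D' h h' m : ℕ} (h₁ : D ≤ m) (h₂ : D' ≤ m) (h₃ : h + 1 + h' ≤ m) :
    joinDiam D D' h h' ≤ m := max_le (max_le h₁ h₂) h₃

lemma le_joinDiam (D D' h h' : ℕ) : D ≤ joinDiam D D' h h' :=
  le_max_of_le_left (le_max_left _ _)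

/-- Disjoint parts of a tree of diameter `D`, joined to small trees at `x₁` and `x₂`, cannot both
have large diameter: the eccentricities `a₁`, `a₂` of `x₁`, `x₂` in the parts add up to less
than `D`. -/
lemma half_joinDiam_add_le {ℓ D D₁ D₂ C₁ C₂ a₁ a₂ b₁ b₂ : ℕ} (hD₁ : D₁ ≤ D) (hD₂ : D₂ ≤ D)
    (hC₁ : C₁ ≤ ℓ) (hC₂ : C₂ ≤ ℓ) (hb₁ : b₁ ≤ ℓ) (hb₂ : b₂ ≤ ℓ) (ha : a₁ + 1 + a₂ ≤ D)
    (h₁ : (joinDiam D₁ C₁ a₁ b₁ - 1) / 2 ≤ ℓ) (h₂ : (joinDiam D₂ C₂ a₂ b₂ - 1) / 2 ≤ ℓ) :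
    (joinDiam D₁ C₁ a₁ b₁ - 1) / 2 + (joinDiam D₂ C₂ a₂ b₂ - 1) / 2 ≤ (D - 1) / 2 + ℓ := by
  have e₁ : joinDiam D₁ C₁ a₁ b₁ ≤ max D (a₁ + 1 + ℓ) :=
    joinDiam_le (by omega) (by omega) (by omega)
  have e₂ : joinDiam D₂ C₂ a₂ b₂ ≤ max D (a₂ + 1 + ℓ) :=
    joinDiam_le (by omega) (by omega) (by omega)
  rcases le_max_iff.1 e₁ with e₁ | e₁
  · omega
  rcases le_max_iff.1 e₂ with e₂ | e₂ <;> omega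

namespace State.IsOptimal

variable {inc : E → Sym2 V} {k d : ℕ} [Fintype V]
variable {s : State inc k} {N : ℕ} {w : ℕ → V}

lemma two_le_order_root (h : s.IsOptimal d N w) : 2 ≤ order s.graph (w 0) := by
  have h1 := h.bad
  have h2 := compDiam_lt_order s.graph (w 0)
  by_contra hlt
  have h3 : compDiam s.graph (w 0) = 0 := by omega
  unfold Bad IsBad at h1
  rw [h3] at h1
  simp at h1
  omega

variable [Finite E]

/-- A later component that an arc from the component of `x` leads to is large in comparison with
the diameter of the merged tree. Otherwise an exchange with the first edge of a longest path
from `x` is an improvement. -/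
lemma half_joinDiam_lt (h : s.IsOptimal d N w) {j t : ℕ} (hj : j < N) (hjt : j < t) (ht : t < N)
    {x : V} {f : E} (hx : s.graph.Reachable (w j) x) (hf : f ∉ s.red) (hft : s.o.tail f = x)
    (hfh : s.o.head f = w t) :
    (joinDiam (compDiam s.graph x) (compDiam s.graph (w t)) (ecc s.graph x)
      (ecc s.graph (w t)) - 1) / 2 < order s.graph (w t) := by
  by_contra! hcon
  have h1 := compDiam_le_two_mul_ecc s.graph x
  have h2 := compDiam_lt_order s.graph (w t)
  have h3 := ecc_le_compDiam s.graph (w t)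
  have h4 := order_pos s.graph (w t)
  have hpos : order s.graph (w t) + 1 ≤ ecc s.graph x := by
    unfold joinDiam at hcon; omega
  obtain ⟨e, he, v, hi, hev⟩ :=
    s.forest.exists_cut_ecc (x := x) (Nat.lt_of_lt_of_le (Nat.succ_pos _) hpos)
  have hJ : Joins (edgeGraph inc (s.red \ {e})) s.graph x v := s.forest.joins he hi
  have h5 := ecc_lt_order (edgeGraph inc (s.red \ {e})) v
  have h6 := ecc_le_compDiam (edgeGraph inc (s.red \ {e})) v
  have h7 := hJ.order_add
  have h8 := hJ.compDiam_left
  have hev' : ecc s.graph x = ecc (edgeGraph inc (s.red \ {e})) v + 1 := hev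
  refine h.no_exchange_at hj hjt ht hx he hi hf hft hfh (Or.inr (by omega)) fun hb => ⟨?_, by omega⟩
  exact IsBad.mono hb (by omega) (by omega)

/-- Merging the component of `x` with a later component that an arc leaving `x` leads to gives a
bad tree. -/
lemma isBad_join (h : s.IsOptimal d N w) {j t : ℕ} (hj : j < N) (hjt : j < t) (ht : t < N)
    {x : V} {f : E} (hx : s.graph.Reachable (w j) x) (hf : f ∉ s.red) (hft : s.o.tail f = x)
    (hfh : s.o.head f = w t) :
    IsBad k d (order s.graph x + order s.graph (w t))
      (joinDiam (compDiam s.graph x) (compDiam s.graph (w t)) (ecc s.graph x)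
        (ecc s.graph (w t))) := by
  rcases Nat.eq_zero_or_pos j with rfl | hj0
  · have h1 : s.Bad d x := (bad_congr hx).1 h.bad
    exact IsBad.mono h1 (by omega) (le_joinDiam _ _ _ _)
  by_cases hxw : x = w j
  · subst hxw
    exact h.isBad_merge h.two_le_order_root hj0 hj hjt ht hf hft hfh
  obtain ⟨e, he, v, hi, hvw⟩ := s.forest.exists_cut hx.symm hxw
  have hJ : Joins (edgeGraph inc (s.red \ {e})) s.graph x v := s.forest.joins he hi
  by_contra hbad
  refine h.no_exchange_at hj hjt ht hx he hi hf hft hfh (Or.inl hvw) fun hb => absurd ?_ hbad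
  have h1 := hJ.order_add
  exact IsBad.mono hb (by omega) (joinDiam_mono hJ.compDiam_le hJ.ecc_le)

/-- The arcs from one component to later small components all leave the same vertex. If there were
two such vertices `x`, `x'`, let `A ∋ x` and `B ∋ x'` be the parts cut off by the edges at
`x` and `x'` on the path between them. The exchanges at `x` and `x'` are not improvements, so
both `A` and `B`, extended by the small components, are bad trees, but then the component itself
is bad and the exchanges are improvements for that reason. -/
lemma tail_eq_tail (h : s.IsOptimal d N w) (hk : 1 ≤ k) {ℓ j t t' : ℕ} (hℓ : (k + 1) * ℓ < d)
    (hj : j < N) (hjt : j < t) (ht : t < N) (hjt' : j < t') (ht' : t' < N) {x x' : V} {f f' : E}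
    (hx : s.graph.Reachable (w j) x) (hf : f ∉ s.red) (hft : s.o.tail f = x)
    (hfh : s.o.head f = w t) (hx' : s.graph.Reachable (w j) x') (hf' : f' ∉ s.red)
    (hft' : s.o.tail f' = x') (hfh' : s.o.head f' = w t')
    (hn : order s.graph (w t) ≤ ℓ + 1) (hn' : order s.graph (w t') ≤ ℓ + 1) : x = x' := by
  by_contra hne
  have hxx' : s.graph.Reachable x x' := hx.symm.trans hx'
  obtain ⟨e, he, v, hi, hvx'⟩ := s.forest.exists_cut hxx' hne
  obtain ⟨e', he', v', hi', hvx⟩ := s.forest.exists_cut hxx'.symm (Ne.symm hne)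
  have hJ : Joins (edgeGraph inc (s.red \ {e})) s.graph x v := s.forest.joins he hi
  have hJ' : Joins (edgeGraph inc (s.red \ {e'})) s.graph x' v' := s.forest.joins he' hi'
  obtain ⟨hBv, hecc⟩ := s.forest.order_ecc_of_cut_of_cut he he' hi hi' hvx' hvx
  obtain ⟨hAv, -⟩ := s.forest.order_ecc_of_cut_of_cut he' he hi' hi hvx hvx'
  change _ ≤ compDiam s.graph x at hecc
  have a1 := hJ.order_add
  have a2 := hJ.compDiam_le
  have a3 := hJ.ecc_le
  have b1 := hJ'.order_add
  have b2 := hJ'.compDiam_le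
  have b3 := hJ'.ecc_le
  have c1 : order s.graph x' = order s.graph x := (order_eq hxx').symm
  have c2 : compDiam s.graph x' = compDiam s.graph x := (compDiam_eq hxx').symm
  have d1 := h.half_joinDiam_lt hj hjt ht hx hf hft hfh
  have d2 := h.half_joinDiam_lt hj hjt' ht' hx' hf' hft' hfh'
  have hex := h.no_exchange_at hj hjt ht hx he hi hf hft hfh
  have hex' := h.no_exchange_at hj hjt' ht' hx' he' hi' hf' hft' hfh'
  set A := edgeGraph inc (s.red \ {e}) with hA
  set B := edgeGraph inc (s.red \ {e'}) with hB
  have hD := compDiam_lt_order s.graph x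
  have t1 := compDiam_lt_order s.graph (w t)
  have t2 := compDiam_lt_order s.graph (w t')
  have t3 := ecc_lt_order s.graph (w t)
  have t4 := ecc_lt_order s.graph (w t')
  have m1 : joinDiam (compDiam A x) (compDiam s.graph (w t)) (ecc A x) (ecc s.graph (w t)) ≤
      joinDiam (compDiam s.graph x) (compDiam s.graph (w t)) (ecc s.graph x)
        (ecc s.graph (w t)) := joinDiam_mono (by omega) (by omega)
  have m2 : joinDiam (compDiam B x') (compDiam s.graph (w t')) (ecc B x') (ecc s.graph (w t')) ≤
      joinDiam (compDiam s.graph x') (compDiam s.graph (w t')) (ecc s.graph x')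
        (ecc s.graph (w t')) := joinDiam_mono (by omega) (by omega)
  by_cases hK : s.Bad d x
  · have h1 : order A v ≤ order s.graph (w t) := by
      by_contra! hlt
      exact hex (Or.inr hlt) fun _ => ⟨hK, hlt⟩
    have h2 : order B v' ≤ order s.graph (w t') := by
      by_contra! hlt
      exact hex' (Or.inr hlt) fun _ => ⟨(bad_congr hxx').1 hK, hlt⟩
    exact not_isBad_of_small hk hℓ (by omega) (by omega) hK
  have hK' : ¬ s.Bad d x' := fun h1 => hK ((bad_congr hxx').2 h1)
  have hbad : IsBad k d (order A x + order s.graph (w t))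
      (joinDiam (compDiam A x) (compDiam s.graph (w t)) (ecc A x) (ecc s.graph (w t))) ∧
      IsBad k d (order B x' + order s.graph (w t'))
      (joinDiam (compDiam B x') (compDiam s.graph (w t')) (ecc B x') (ecc s.graph (w t'))) := by
    -- `A` and `B` are disjoint, so that one of them does not contain `w j`
    rcases hJ'.reachable_left_iff.1 hx'.symm with h1 | h1
    · have hvw : A.Reachable v (w j) :=
        s.forest.reachable_of_cut_of_cut he he' hi hi' hvx' hvx h1
      have h2 : IsBad k d (order A x + order s.graph (w t))
          (joinDiam (compDiam A x) (compDiam s.graph (w t)) (ecc A x) (ecc s.graph (w t))) := by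
        by_contra hcon
        exact hex (Or.inl hvw) fun hb => absurd hb hcon
      refine ⟨h2, ?_⟩
      by_contra hcon
      have h3 := le_of_isBad_add hk hℓ h2 (by omega) hn
      exact hex' (Or.inr (by omega)) fun hb => absurd hb hcon
    · have h2 : IsBad k d (order B x' + order s.graph (w t'))
          (joinDiam (compDiam B x') (compDiam s.graph (w t')) (ecc B x')
            (ecc s.graph (w t'))) := by
        by_contra hcon
        exact hex' (Or.inl h1) fun hb => absurd hb hcon
      refine ⟨?_, h2⟩
      by_contra hcon
      have h3 := le_of_isBad_add hk hℓ h2 (by omega) hn'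
      exact hex (Or.inr (by omega)) fun hb => absurd hb hcon
  refine hK (isBad_of_isBad_add_of_isBad_add hk hℓ hbad.1 hbad.2 (by omega) hn hn' ?_)
  exact half_joinDiam_add_le (by omega) (by omega) (by omega) (by omega) (by omega) (by omega)
    hecc (by omega) (by omega)

end State.IsOptimal

/-! ### Counting the edges of the explored components -/

lemma le_of_isBad_add_of_half_lt {k d n c D : ℕ} (hk : 1 ≤ k) (hn : 0 < n)
    (h : IsBad k d (n + c) D) (hD : (D - 1) / 2 < c) : d ≤ (n - 1) + k * (c - 1) := by
  obtain ⟨k, rfl⟩ := Nat.exists_eq_add_of_le' hk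
  have h1 : k * ((D - 1) / 2) ≤ k * (c - 1) := Nat.mul_le_mul_left k (by omega)
  have h2 : (k + 1) * (c - 1) = k * (c - 1) + (c - 1) := by ring
  unfold IsBad at h
  simp only [Nat.add_sub_cancel] at h
  omega

lemma lt_of_isBad_of_half_lt {k d n c D : ℕ} (hk : 1 ≤ k) (hn : 0 < n)
    (h : IsBad k d n D) (hD : (D - 1) / 2 < c) : d < (n - 1) + k * (c - 1) := by
  obtain ⟨k, rfl⟩ := Nat.exists_eq_add_of_le' hk
  have h1 : k * ((D - 1) / 2) ≤ k * (c - 1) := Nat.mul_le_mul_left k (by omega)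
  have h2 : (k + 1) * (c - 1) = k * (c - 1) + (c - 1) := by ring
  unfold IsBad at h
  simp only [Nat.add_sub_cancel] at h
  omega

lemma lt_mul_of_isBad {k d n D : ℕ} (hk : 1 ≤ k) (h : IsBad k d n D) (hD : D < n) :
    d < (k + 1) * (n - 1) := by
  have h1 := lt_of_isBad_of_half_lt hk (by omega) h (show (D - 1) / 2 < n by omega)
  have h2 : (k + 1) * (n - 1) = (n - 1) + k * (n - 1) := by ring
  omega

/-- A family `C` of at most `k` trees with `c t` edges, all joined to a tree with `e` edges: if
`d + δ ≤ e + k * c t` for each of them, then the sum of all weights is at least `δ`. -/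
lemma le_weight_add_sum {ι : Type*} (C : Finset ι) (c : ι → ℤ) {k d e δ : ℤ} (hk : 1 ≤ k)
    (hC : (C.card : ℤ) ≤ k) (hδ : 0 ≤ δ) (he : d + δ ≤ (k + 1) * e)
    (h : ∀ t ∈ C, d + δ ≤ e + k * c t) :
    δ ≤ ((k + 1) * e - d) + ∑ t ∈ C, ((k + 1) * c t - d) := by
  have h1 : ∀ t ∈ C, (k + 1) * (d + δ - e) - k * d ≤ k * ((k + 1) * c t - d) := fun t ht => by
    nlinarith [h t ht]
  have h2 := Finset.card_nsmul_le_sum C _ _ h1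
  rw [nsmul_eq_mul, ← Finset.mul_sum] at h2
  set m : ℤ := (C.card : ℤ)
  set T := ∑ t ∈ C, ((k + 1) * c t - d)
  have hm : 0 ≤ m := Int.natCast_nonneg _
  have h3 : 0 ≤ (k - m) * ((k + 1) * e - (d + δ)) := mul_nonneg (by linarith) (by linarith)
  have h4 : k * δ ≤ k * (((k + 1) * e - d) + T) := by nlinarith [mul_nonneg hm hδ]
  exact le_of_mul_le_mul_left h4 (by linarith)

namespace State

variable {inc : E → Sym2 V} {k : ℕ} [Fintype V]

open scoped Classical in
/-- The vertices of the explored components. -/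
noncomputable def explored (s : State inc k) (N : ℕ) (w : ℕ → V) : Finset V :=
  (Finset.range N).biUnion fun t => comp s.graph (w t)

lemma mem_explored {s : State inc k} {N : ℕ} {w : ℕ → V} {u : V} :
    u ∈ s.explored N w ↔ ∃ t < N, s.graph.Reachable (w t) u := by
  simp [explored]

end State

namespace State.IsOptimal

variable {inc : E → Sym2 V} {k d : ℕ} [Fintype V]
variable {s : State inc k} {N : ℕ} {w : ℕ → V}

lemma eq_of_reachable (h : s.IsOptimal d N w) {i j : ℕ} (hi : i < N) (hj : j < N)
    (hij : s.graph.Reachable (w i) (w j)) : i = j := by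
  rcases lt_trichotomy i j with h1 | h1 | h1
  · exact absurd hij (h.distinct j hj i h1)
  · exact h1
  · exact absurd hij.symm (h.distinct i hi j h1)

/-- If the blue out-degree were smaller, then some explored component could lose a red edge, by
turning this edge blue and reversing a blue path. -/
lemma outdeg_eq [Finite E] (h : s.IsOptimal d N w) {j : ℕ} (hj : j < N) {z : V}
    (hz : s.graph.Reachable (w j) z) : s.o.outdeg s.red z = k := by
  by_contra hne
  have hlt : s.o.outdeg s.red z < k := lt_of_le_of_ne (s.outdeg_le z) hne
  by_cases hn : 2 ≤ order s.graph z
  · exact h.no_deficient_path hj hz hn (S := ∅) (fun a ha => absurd ha (Set.notMem_empty a))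
      .refl hlt
  have hn' : order s.graph (w j) ≤ 1 := by rw [order_eq hz]; omega
  obtain rfl := eq_of_order_le_one hn' hz
  have hj0 : 0 < j := by
    refine Nat.pos_of_ne_zero fun h0 => ?_
    have := h.two_le_order_root
    rw [h0] at hn'
    omega
  obtain ⟨i, hij, x, hx, hnx, hpath⟩ := h.exists_source h.two_le_order_root hj hj0
  refine h.no_deficient_path (hij.trans hj) hx hnx ?_ hpath hlt
  rintro a ⟨t, h1, h2, h3⟩ t' ht' h4
  have := h.eq_of_reachable (by omega) (by omega) (h4.trans h3.symm)
  omega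

lemma card_explored (h : s.IsOptimal d N w) :
    (s.explored N w).card = ∑ t ∈ Finset.range N, order s.graph (w t) := by
  classical
  refine Finset.card_biUnion fun i hi j hj hij => Finset.disjoint_left.2 fun a ha ha' => hij ?_
  rw [mem_comp] at ha ha'
  exact h.eq_of_reachable (Finset.mem_range.1 hi) (Finset.mem_range.1 hj) (ha.trans ha'.symm)

/-- The explored vertices span `k` blue edges per vertex, and the edges of spanning trees of the
components: each vertex other than the `w t` has a red edge towards the `w t` of its component. -/
lemma le_card_edgesIn [Fintype E] (h : s.IsOptimal d N w) :
    (k + 1) * (s.explored N w).card ≤ (edgesIn inc (s.explored N w)).card + N := by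
  classical
  set H := s.explored N w with hH
  have hblue : k * H.card ≤ ((edgesIn inc H).filter fun e => e ∉ s.red).card := by
    have h1 : ∀ u ∈ H,
        k ≤ (((edgesIn inc H).filter fun e => e ∉ s.red).filter fun e => s.o.tail e = u).card := by
      intro u hu
      obtain ⟨j, hj, hju⟩ := mem_explored.1 hu
      rw [← Set.ncard_coe_finset]
      refine (h.outdeg_eq hj hju).ge.trans (Set.ncard_le_ncard ?_ (Finset.finite_toSet _))
      rintro e ⟨he, rfl⟩
      simp only [Finset.coe_filter, Finset.mem_filter, Set.mem_ofPred_eq, s.o.mem_edgesIn]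
      exact ⟨⟨⟨hu, mem_explored.2 (h.exists_reachable_head hj he hju)⟩, he⟩, trivial⟩
    rw [Finset.card_eq_sum_card_fiberwise (t := H) (f := s.o.tail) fun e he =>
      (s.o.mem_edgesIn.1 (Finset.mem_filter.1 he).1).1, mul_comm]
    exact Finset.card_nsmul_le_sum H _ _ h1
  have hred : H.card ≤ ((edgesIn inc H).filter fun e => ¬ e ∉ s.red).card + N := by
    let H' : Finset V := H \ (Finset.range N).image w
    have h2 : H'.card ≤ ((edgesIn inc H).filter fun e => ¬ e ∉ s.red).card := by
      refine Finset.card_le_card_of_forall_subsingleton (fun u e => ∃ v, ∃ t < N,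
        inc e = s(u, v) ∧ s.graph.Reachable (w t) u ∧ s.graph.Reachable (w t) v ∧
          s.graph.dist v (w t) + 1 = s.graph.dist u (w t)) (fun u hu => ?_) fun e _ => ?_
      · rw [Finset.mem_sdiff, Finset.mem_image] at hu
        obtain ⟨t, ht, htu⟩ := mem_explored.1 hu.1
        have hne : u ≠ w t := fun hne => hu.2 ⟨t, Finset.mem_range.2 ht, hne.symm⟩
        obtain ⟨v, ⟨-, e, he, hi⟩, hv, hd⟩ := exists_adj_dist_add_one htu.symm hne
        refine ⟨e, ?_, v, t, ht, hi, htu, hv.symm, hd⟩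
        rw [Finset.mem_filter, mem_edgesIn, hi, not_not]
        refine ⟨?_, he⟩
        simp only [Sym2.mem_iff, forall_eq_or_imp, forall_eq]
        exact ⟨hu.1, mem_explored.2 ⟨t, ht, hv.symm⟩⟩
      · rintro u ⟨-, v, t, ht, hi, hu, hv, hd⟩ u' ⟨-, v', t', ht', hi', hu', hv', hd'⟩
        rw [hi, Sym2.eq_iff] at hi'
        rcases hi' with ⟨h3, -⟩ | ⟨h3, h4⟩
        · exact h3
        · exfalso
          subst h3 h4
          obtain rfl := h.eq_of_reachable ht ht' (hv.trans hu'.symm)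
          omega
    have h3 := Finset.card_le_card_sdiff_add_card (s := H) (t := (Finset.range N).image w)
    have h4 := Finset.card_image_le (s := Finset.range N) (f := w)
    rw [Finset.card_range] at h4
    change H.card ≤ H'.card + _ at h3
    omega
  have := Finset.card_filter_add_card_filter_not (s := edgesIn inc H) (fun e => e ∉ s.red)
  rw [add_mul, one_mul]
  omega

/-- On average, the explored components are too large. A component with `n` vertices has weight
`(k + 1) * (n - 1) - d`. The small components, those of negative weight, are compensated for by
the components that they are explored from: these are not small, and each of them has at most `k`
small children, as the arcs to the latter all leave the same vertex. -/
lemma sum_weight_pos [Finite E] (h : s.IsOptimal d N w) (hk : 1 ≤ k) :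
    0 < ∑ t ∈ Finset.range N, (((k : ℤ) + 1) * ((order s.graph (w t) : ℤ) - 1) - d) := by
  classical
  let W : ℕ → ℤ := fun t => ((k : ℤ) + 1) * ((order s.graph (w t) : ℤ) - 1) - d
  change 0 < ∑ t ∈ Finset.range N, W t
  let small : ℕ → Prop := fun t => (k + 1) * (order s.graph (w t) - 1) < d
  have hcast : ∀ u, ((order s.graph u - 1 : ℕ) : ℤ) = (order s.graph u : ℤ) - 1 := fun u => by
    have := order_pos s.graph u
    omega
  have hpar : ∀ t, ∃ j, 0 < t → t < N → j < t ∧ ∃ e ∉ s.red,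
      s.graph.Reachable (w j) (s.o.tail e) ∧ s.o.head e = w t := by
    intro t
    by_cases ht : 0 < t ∧ t < N
    · obtain ⟨j, hj, e, he⟩ := h.arc t ht.2 ht.1
      exact ⟨j, fun _ _ => ⟨hj, e, he⟩⟩
    · exact ⟨0, fun h1 h2 => absurd ⟨h1, h2⟩ ht⟩
  choose par hpar using hpar
  have hroot : d < (k + 1) * (order s.graph (w 0) - 1) :=
    lt_mul_of_isBad hk h.bad (compDiam_lt_order _ _)
  have hpos : ∀ t, small t → 0 < t := fun t ht => by
    refine Nat.pos_of_ne_zero fun h0 => ?_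
    have ht' : (k + 1) * (order s.graph (w t) - 1) < d := ht
    rw [h0] at ht'
    omega
  have hparN : ∀ t < N, small t → par t < N := fun t ht hs =>
    (hpar t (hpos t hs) ht).1.trans ht
  have hlarge : ∀ t < N, small t → ¬ small (par t) := by
    intro t ht hs hs'
    obtain ⟨hjt, f, hf, hx, hfh⟩ := hpar t (hpos t hs) ht
    have h1 := h.half_joinDiam_lt (hjt.trans ht) hjt ht hx hf rfl hfh
    have h2 := h.isBad_join (hjt.trans ht) hjt ht hx hf rfl hfh
    rw [← order_eq hx] at h2
    refine not_isBad_of_small (ℓ := max (order s.graph (w t)) (order s.graph (w (par t))) - 1)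
      hk ?_ (by omega) (by omega) h2
    rcases max_cases (order s.graph (w t)) (order s.graph (w (par t))) with ⟨h3, -⟩ | ⟨h3, -⟩
    · rw [h3]; exact hs
    · rw [h3]; exact hs'
  let C : ℕ → Finset ℕ := fun j => ((Finset.range N).filter small).filter fun t => par t = j
  have hC : ∀ j t, t ∈ C j ↔ (t < N ∧ small t) ∧ par t = j := fun j t => by simp [C]
  have hcard : ∀ j, (C j).card ≤ k := by
    intro j
    rcases (C j).eq_empty_or_nonempty with h0 | ⟨t₀, ht₀⟩
    · simp [h0]
    obtain ⟨⟨hN₀, hs₀⟩, rfl⟩ := (hC _ _).1 ht₀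
    obtain ⟨hjt₀, f₀, hf₀, hx₀, hfh₀⟩ := hpar t₀ (hpos t₀ hs₀) hN₀
    refine le_trans ?_ (s.outdeg_le (s.o.tail f₀))
    have hinj : Set.InjOn w (C (par t₀)) := fun a ha b hb hab =>
      h.eq_of_reachable ((hC _ _).1 ha).1.1 ((hC _ _).1 hb).1.1 (hab ▸ .rfl)
    rw [← Set.ncard_coe_finset, ← hinj.ncard_image]
    refine (Set.ncard_le_ncard (t := s.o.head '' {e | e ∉ s.red ∧ s.o.tail e = s.o.tail f₀})
      ?_ (Set.toFinite _)).trans (Set.ncard_image_le (Set.toFinite _))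
    rintro _ ⟨t, ht, rfl⟩
    obtain ⟨⟨hN, hs⟩, hpt⟩ := (hC _ _).1 ht
    obtain ⟨hjt, f, hf, hx, hfh⟩ := hpar t (hpos t hs) hN
    rw [hpt] at hjt hx
    refine ⟨f, ⟨hf, ?_⟩, hfh⟩
    refine h.tail_eq_tail hk (ℓ := max (order s.graph (w t)) (order s.graph (w t₀)) - 1) ?_
      (hjt.trans hN) hjt hN hjt₀ hN₀ hx hf rfl hfh hx₀ hf₀ rfl hfh₀ (by omega) (by omega)
    rcases max_cases (order s.graph (w t)) (order s.graph (w t₀)) with ⟨h3, -⟩ | ⟨h3, -⟩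
    · rw [h3]; exact hs
    · rw [h3]; exact hs₀
  have hgroup : ∑ t ∈ Finset.range N, W t =
      ∑ j ∈ (Finset.range N).filter (fun j => ¬ small j), (W j + ∑ t ∈ C j, W t) := by
    rw [← Finset.sum_filter_add_sum_filter_not (Finset.range N) small, Finset.sum_add_distrib,
      add_comm]
    congr 1
    refine (Finset.sum_fiberwise_of_maps_to (fun t ht => ?_) _).symm
    rw [Finset.mem_filter, Finset.mem_range] at ht ⊢
    exact ⟨hparN t ht.1 ht.2, hlarge t ht.1 ht.2⟩
  rw [hgroup]
  refine Finset.sum_pos' (fun j hj => ?_) ⟨0, ?_, ?_⟩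
  · rw [Finset.mem_filter, Finset.mem_range] at hj
    have hj2 : d ≤ (k + 1) * (order s.graph (w j) - 1) := not_lt.1 hj.2
    refine le_weight_add_sum (C j) (fun t => (order s.graph (w t) : ℤ) - 1) (by exact_mod_cast hk)
      (by exact_mod_cast hcard j) le_rfl ?_ fun t ht => ?_
    · rw [← hcast]
      exact_mod_cast hj2
    · obtain ⟨⟨hN, hs⟩, rfl⟩ := (hC _ _).1 ht
      obtain ⟨hjt, f, hf, hx, hfh⟩ := hpar t (hpos t hs) hN
      have h1 := h.half_joinDiam_lt hj.1 hjt hN hx hf rfl hfh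
      have h2 := h.isBad_join hj.1 hjt hN hx hf rfl hfh
      have h3 := le_of_isBad_add_of_half_lt hk (order_pos _ _) h2 h1
      rw [← order_eq hx] at h3
      rw [← hcast, ← hcast]
      exact_mod_cast h3
  · rw [Finset.mem_filter, Finset.mem_range]
    exact ⟨h.pos, not_lt.2 hroot.le⟩
  · refine lt_of_lt_of_le one_pos (le_weight_add_sum (C 0)
      (fun t => (order s.graph (w t) : ℤ) - 1) (by exact_mod_cast hk)
      (by exact_mod_cast hcard 0) zero_le_one ?_ fun t ht => ?_)
    · rw [← hcast]
      exact_mod_cast hroot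
    · obtain ⟨⟨hN, hs⟩, hpt⟩ := (hC _ _).1 ht
      obtain ⟨hjt, f, hf, hx, hfh⟩ := hpar t (hpos t hs) hN
      rw [hpt] at hjt hx
      have h1 := h.half_joinDiam_lt h.pos hjt hN hx hf rfl hfh
      have h2 := le_joinDiam (compDiam s.graph (s.o.tail f)) (compDiam s.graph (w t))
        (ecc s.graph (s.o.tail f)) (ecc s.graph (w t))
      rw [← compDiam_eq hx] at h1 h2
      have h3 := lt_of_isBad_of_half_lt hk (order_pos _ _) h.bad
        (show (compDiam s.graph (w 0) - 1) / 2 < order s.graph (w t) by omega)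
      rw [← hcast, ← hcast]
      exact_mod_cast h3

end State.IsOptimal

/-- A sparse multigraph decomposes into edges oriented with out-degrees at
most `k` and a forest without bad components. -/
theorem exists_state_not_bad [Fintype V] [Fintype E] {inc : E → Sym2 V} {k d : ℕ} (hk : 1 ≤ k)
    (hX : ∀ X : Finset V, (d + k + 1) * (edgesIn inc X).card ≤ (k + 1) * (d + k) * X.card) :
    ∃ s : State inc k, ∀ u, ¬ s.Bad d u := by
  have : Nonempty (State inc k) := exists_state fun X hXne => by
    have h1 := hX X
    have h2 : 0 < X.card := hXne.card_pos
    by_contra! h3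
    have h4 : (d + k + 1) * ((k + 1) * X.card) ≤ (k + 1) * (d + k) * X.card :=
      (Nat.mul_le_mul_left _ h3).trans h1
    nlinarith
  by_contra! hcon
  obtain ⟨s, N, w, h⟩ := State.exists_isOptimal hcon
  have h1 := h.sum_weight_pos hk
  have h2 := h.le_card_edgesIn
  have h3 := hX (s.explored N w)
  have h4 := h.card_explored
  set n := (s.explored N w).card
  set m := (edgesIn inc (s.explored N w)).card
  have h5 : ∑ t ∈ Finset.range N, (((k : ℤ) + 1) * ((order s.graph (w t) : ℤ) - 1) - d) =
      (k + 1) * n - (d + k + 1) * N := by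
    rw [h4, Finset.sum_sub_distrib, ← Finset.mul_sum, Finset.sum_sub_distrib]
    simp only [Finset.sum_const, Finset.card_range, nsmul_eq_mul, mul_one]
    push_cast
    ring
  have h6 : (d + k + 1) * ((k + 1) * n) ≤ (d + k + 1) * (m + N) := Nat.mul_le_mul_left _ h2
  have h7 : (k + 1) * n ≤ (d + k + 1) * N := by nlinarith
  rw [h5] at h1
  have h8 : ((k : ℤ) + 1) * n ≤ (d + k + 1) * N := by exact_mod_cast h7
  linarith

/-! ### Pseudoforests and forests as subgraphs of a multigraph -/

variable {α β : Type*}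

section Pseudoforest

open scoped Fin.CommRing in
/-- Along a cycle of a graph oriented with out-degrees at most one, the edges are oriented
consistently: following the arcs leads from each vertex of the cycle to every other one. -/
lemma exists_iterate_eq_of_isCycle {H C : Graph α β} {t h : β → α} {f : α → α}
    (hlink : ∀ e ∈ E(H), H.IsLink e (t e) (h e)) (hinj : Set.InjOn t E(H))
    (hf : ∀ e ∈ E(H), f (t e) = h e) (hCH : C ≤ H) (hC : C.IsCycle) :
    (∀ a ∈ V(C), ∀ m, f^[m] a ∈ V(C)) ∧ (∀ a ∈ V(C), ∀ b ∈ V(C), ∃ m, f^[m] a = b) ∧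
      ∀ a ∈ V(C), ∃ e ∈ E(C), t e = a := by
  obtain ⟨n, v, e, hv, he, hV, hE, hl⟩ := hC
  have heH : ∀ i, e i ∈ E(H) := fun i => ((hl i).mono hCH).edge_mem
  have hσ : ∀ i, ∃ j, v j = t (e i) ∧ (j = i ∨ j = i + 1) := by
    intro i
    rcases (hlink _ (heH i)).left_eq_or_eq ((hl i).mono hCH) with h1 | h1
    · exact ⟨i, h1.symm, Or.inl rfl⟩
    · exact ⟨i + 1, h1.symm, Or.inr rfl⟩
  choose σ hσt hσi using hσ
  have hσinj : Function.Injective σ := fun i j hij => by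
    refine he (hinj (heH i) (heH j) ?_)
    rw [← hσt, ← hσt, hij]
  have hσsurj : Function.Surjective σ := Finite.surjective_of_injective hσinj
  have htail : ∀ a ∈ V(C), ∃ e ∈ E(C), t e = a := by
    intro a ha
    rw [← hV] at ha
    obtain ⟨j, rfl⟩ := ha
    obtain ⟨i, rfl⟩ := hσsurj j
    exact ⟨e i, hE ▸ Set.mem_range_self i, (hσt i).symm⟩
  have hstep : ∃ c : Fin (n + 1) → Fin (n + 1) → Fin (n + 1),
      (∀ i (m : ℕ), f^[m] (v i) = v (c i (m : Fin (n + 1)))) ∧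
      ∀ i j, ∃ m : Fin (n + 1), c i m = j := by
    by_cases hall : ∀ i, σ i = i
    · have hfv : ∀ i, f (v i) = v (i + 1) := by
        intro i
        have h1 : v i = t (e i) := by rw [← hσt, hall]
        rw [h1, hf _ (heH i)]
        have h2 := hlink _ (heH i)
        rw [← h1] at h2
        exact h2.right_unique ((hl i).mono hCH)
      refine ⟨fun i m => i + m, fun i m => ?_, fun i j => ⟨j - i, by simp⟩⟩
      induction m with
      | zero => simp
      | succ m ih =>
        rw [Function.iterate_succ_apply', ih, hfv]
        push_cast
        rw [add_assoc]
    · have hall' : ∀ i, σ i = i + 1 := by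
        push Not at hall
        obtain ⟨i₀, hi₀⟩ := hall
        have h1 : ∀ m : ℕ, σ (i₀ + (m : Fin (n + 1))) = i₀ + (m : Fin (n + 1)) + 1 := by
          intro m
          induction m with
          | zero => simpa using (hσi i₀).resolve_left hi₀
          | succ m ih =>
            push_cast
            rw [← add_assoc]
            rcases hσi (i₀ + (m : Fin (n + 1)) + 1) with h2 | h2
            · have h3 := hσinj (h2.trans ih.symm)
              rw [h3, ih, h3]
            · exact h2
        intro i
        have h2 := h1 (i - i₀ : Fin (n + 1)).val
        rw [Fin.cast_val_eq_self] at h2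
        simpa using h2
      have hfv : ∀ i, f (v (i + 1)) = v i := by
        intro i
        have h1 : v (i + 1) = t (e i) := by rw [← hσt, hall']
        rw [h1, hf _ (heH i)]
        have h2 := hlink _ (heH i)
        rw [← h1] at h2
        exact h2.right_unique ((hl i).mono hCH).symm
      refine ⟨fun i m => i - m, fun i m => ?_, fun i j => ⟨i - j, by simp⟩⟩
      induction m with
      | zero => simp
      | succ m ih =>
        rw [Function.iterate_succ_apply', ih]
        have h1 := hfv (i - (m : Fin (n + 1)) - 1)
        rw [sub_add_cancel] at h1
        rw [h1]
        push_cast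
        rw [sub_sub]
  obtain ⟨c, hc, hcs⟩ := hstep
  refine ⟨fun a ha m => ?_, fun a ha b hb => ?_, htail⟩
  · rw [← hV] at ha ⊢
    obtain ⟨i, rfl⟩ := ha
    exact ⟨_, (hc i m).symm⟩
  · rw [← hV] at ha hb
    obtain ⟨i, rfl⟩ := ha
    obtain ⟨j, rfl⟩ := hb
    obtain ⟨m, hm⟩ := hcs i j
    refine ⟨m.val, ?_⟩
    rw [hc, Fin.cast_val_eq_self, hm]

/-- A graph that can be oriented with out-degrees at most one is a pseudoforest: two cycles of one
component have a common vertex, as the forward orbits of two vertices of one component meet, and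
then both consist of the orbit of this vertex. -/
theorem isPseudoforest_of_injOn {H : Graph α β} {t h : β → α}
    (hlink : ∀ e ∈ E(H), H.IsLink e (t e) (h e)) (hinj : Set.InjOn t E(H)) :
    H.IsPseudoforest := by
  classical
  intro K hK C C' hCK hC hC'K hC'
  have hKH : K ≤ H := hK.prop.1
  let f : α → α := fun a => if ha : ∃ e ∈ E(H), t e = a then h ha.choose else a
  have hf : ∀ e ∈ E(H), f (t e) = h e := by
    intro e he
    have hex : ∃ e' ∈ E(H), t e' = t e := ⟨e, he, rfl⟩
    have h1 : f (t e) = h hex.choose := dif_pos hex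
    rw [h1, hinj hex.choose_spec.1 he hex.choose_spec.2]
  obtain ⟨hm, ho, ht⟩ := exists_iterate_eq_of_isCycle hlink hinj hf (hCK.trans hKH) hC
  obtain ⟨hm', ho', ht'⟩ := exists_iterate_eq_of_isCycle hlink hinj hf (hC'K.trans hKH) hC'
  have hmeet : ∀ a b : V(K), K.underlying.Reachable a b →
      ∃ m m', f^[m] (a : α) = f^[m'] (b : α) := by
    rintro a b ⟨p⟩
    induction p with
    | nil => exact ⟨0, 0, rfl⟩
    | @cons a b c hadj p ih =>
      obtain ⟨q, q', hq⟩ := ih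
      have hab : ∃ e, H.IsLink e (a : α) b := by
        rw [Graph.underlying, SimpleGraph.fromRel_adj] at hadj
        rcases hadj.2 with ⟨e, he⟩ | ⟨e, he⟩
        · exact ⟨e, he.mono hKH⟩
        · exact ⟨e, (he.mono hKH).symm⟩
      obtain ⟨e, he⟩ := hab
      have heH := he.edge_mem
      rcases he.eq_and_eq_or_eq_and_eq (hlink e heH) with ⟨h1, h2⟩ | ⟨h1, h2⟩
      · refine ⟨q + 1, q', ?_⟩
        rw [Function.iterate_succ_apply, h1, hf e heH, ← h2, hq]
      · refine ⟨q, q' + 1, ?_⟩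
        rw [h1, ← hf e heH, ← h2, ← Function.iterate_succ_apply, Function.iterate_succ_apply', hq,
          ← Function.iterate_succ_apply' f]
  have hne : ∀ {D : Graph α β}, D.IsCycle → ∃ a, a ∈ V(D) := by
    rintro D ⟨n, v, e, -, -, hV, -⟩
    exact ⟨v 0, hV ▸ Set.mem_range_self 0⟩
  obtain ⟨a, ha⟩ := hne hC
  obtain ⟨b, hb⟩ := hne hC'
  obtain ⟨m, m', hmm⟩ := hmeet ⟨a, hCK.vertexSet_mono ha⟩ ⟨b, hC'K.vertexSet_mono hb⟩
    (hK.prop.2.preconnected _ _)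
  have hc : f^[m] a ∈ V(C) := hm a ha m
  have hc' : f^[m] a ∈ V(C') := hmm ▸ hm' b hb m'
  have hV : V(C) = V(C') := by
    ext x
    constructor
    · intro hx
      obtain ⟨q, rfl⟩ := ho _ hc x hx
      exact hm' _ hc' q
    · intro hx
      obtain ⟨q, rfl⟩ := ho' _ hc' x hx
      exact hm _ hc q
  have hsub : ∀ {D D' : Graph α β}, D ≤ H → D' ≤ H → V(D) = V(D') →
      (∀ a ∈ V(D'), ∃ e ∈ E(D'), t e = a) → E(D) ⊆ E(D') := by
    intro D D' hD hD' hVD hex e he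
    have heH := hD.edgeSet_mono he
    have h1 : t e ∈ V(D') := hVD ▸ ((hD.isLink_iff he).2 (hlink e heH)).left_mem
    obtain ⟨e', he', h2⟩ := hex _ h1
    rwa [← hinj (hD'.edgeSet_mono he') heH h2]
  have hCH := hCK.trans hKH
  have hC'H := hC'K.trans hKH
  exact Graph.Compatible.ext hV ((hsub hCH hC'H hV ht').antisymm (hsub hC'H hCH hV.symm ht))
    (.of_le_le hCH hC'H)

end Pseudoforest

section Incidence

variable {G : Graph α β}

/-- The pair of ends of an edge of `G`. -/
noncomputable def ends (G : Graph α β) (e : E(G)) : Sym2 V(G) :=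
  s(⟨_, (Graph.exists_isLink_of_mem_edgeSet e.2).choose_spec.choose_spec.left_mem⟩,
    ⟨_, (Graph.exists_isLink_of_mem_edgeSet e.2).choose_spec.choose_spec.right_mem⟩)

lemma ends_eq_iff {e : E(G)} {a b : V(G)} : ends G e = s(a, b) ↔ G.IsLink e a b := by
  have h := (Graph.exists_isLink_of_mem_edgeSet e.2).choose_spec.choose_spec
  rw [h.isLink_iff, ends, Sym2.eq_iff, Subtype.ext_iff, Subtype.ext_iff, Subtype.ext_iff,
    Subtype.ext_iff]

/-- The spanning subgraph of `G` with edge set `R`. -/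
def spanningSubgraph (G : Graph α β) (R : Set E(G)) : Graph α β := G.restrict ((↑) '' R)

variable {R : Set E(G)}

lemma spanningSubgraph_le : spanningSubgraph G R ≤ G := Graph.restrict_le

lemma mem_of_isLink_spanningSubgraph {e : β} {a b : α} (h : (spanningSubgraph G R).IsLink e a b) :
    ∃ e' ∈ R, (e' : β) = e ∧ ∃ a' b' : V(G), (a' : α) = a ∧ (b' : α) = b ∧
      ends G e' = s(a', b') := by
  obtain ⟨⟨e', he', rfl⟩, h1⟩ := h
  exact ⟨e', he', rfl, ⟨a, h1.left_mem⟩, ⟨b, h1.right_mem⟩, rfl, rfl, ends_eq_iff.2 h1⟩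

lemma isLink_spanningSubgraph {e : E(G)} (he : e ∈ R) {a b : V(G)} (h : ends G e = s(a, b)) :
    (spanningSubgraph G R).IsLink e a b := ⟨⟨e, he, rfl⟩, ends_eq_iff.1 h⟩

lemma edgeSet_spanningSubgraph : E(spanningSubgraph G R) = (↑) '' R := by
  change E(G) ∩ (↑) '' R = _
  rw [Set.inter_eq_right]
  rintro _ ⟨e, -, rfl⟩
  exact e.2

/-- The edges of a cycle except for one of them connect the ends of the latter. -/
lemma IsForest.isAcyclic (hR : IsForest (ends G) R) : (spanningSubgraph G R).IsAcyclic := by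
  rintro C hCR ⟨n, v, e, hv, he, -, -, hl⟩
  have hl' := fun i => mem_of_isLink_spanningSubgraph ((hl i).mono hCR)
  choose e' he'R he' a b ha hb hi using hl'
  have hab : ∀ i, b i = a (i + 1) := fun i => Subtype.ext ((hb i).trans (ha (i + 1)).symm)
  have hne : ∀ i, i ≠ Fin.last n → e' i ≠ e' (Fin.last n) := fun i hin h =>
    hin (he (by rw [← he', ← he', h]))
  have key : ∀ m (hm : m < n + 1),
      (edgeGraph (ends G) (R \ {e' (Fin.last n)})).Reachable (a 0) (a ⟨m, hm⟩) := by
    intro m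
    induction m with
    | zero => exact fun _ => .rfl
    | succ m ih =>
      intro hm
      refine (ih (by omega)).trans (reachable_of_mem (e := e' ⟨m, by omega⟩) ⟨he'R _, ?_⟩ ?_)
      · refine hne _ fun h => ?_
        rw [Fin.ext_iff, Fin.val_last] at h
        simp only at h
        omega
      · rw [hi, hab]
        congr 3
        exact Fin.ext (by
          rw [Fin.val_add_one_of_lt (by rw [Fin.lt_def, Fin.val_last]; simp only; omega)])
  refine hR _ (he'R (Fin.last n)) _ _ (hi _) ?_
  rw [hab, Fin.last_add_one]
  exact (key n (by omega)).symm

end Incidence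

/-! ### Components of the decomposition, and the density condition -/

/-- A tree with `n` vertices has at most `n - 1` edges. -/
lemma ncard_lt_order {V E : Type*} [Fintype V] [Finite E] {inc : E → Sym2 V} {R : Set E}
    (hR : IsForest inc R) (u : V) :
    {e | e ∈ R ∧ ∀ a ∈ inc e, (edgeGraph inc R).Reachable u a}.ncard <
      order (edgeGraph inc R) u := by
  induction R, R.toFinite using Set.Finite.induction_on generalizing u with
  | empty => simpa using order_pos _ u
  | @insert e R heR _ ih =>
    have hR' : IsForest inc R := hR.mono (Set.subset_insert e R)
    obtain ⟨⟨p, q⟩, hpq⟩ := Quot.exists_rep (inc e)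
    have hi : inc e = s(p, q) := hpq.symm
    have hJ : Joins (edgeGraph inc R) (edgeGraph inc (insert e R)) p q := by
      have h1 := hR.joins (Set.mem_insert e R) hi
      rwa [Set.insert_sdiff_of_mem _ (Set.mem_singleton e),
        Set.sdiff_singleton_eq_self heR] at h1
    by_cases hu : (edgeGraph inc (insert e R)).Reachable p u
    · rw [← order_eq hu, hJ.order_add]
      have h1 := ih hR' p
      have h2 := ih hR' q
      have h3 : {f | f ∈ insert e R ∧
            ∀ a ∈ inc f, (edgeGraph inc (insert e R)).Reachable u a} ⊆
          insert e ({f | f ∈ R ∧ ∀ a ∈ inc f, (edgeGraph inc R).Reachable p a} ∪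
            {f | f ∈ R ∧ ∀ a ∈ inc f, (edgeGraph inc R).Reachable q a}) := by
        rintro f ⟨rfl | hf, hfu⟩
        · exact Set.mem_insert _ _
        refine Set.mem_insert_of_mem _ ?_
        obtain ⟨⟨a, b⟩, hab⟩ := Quot.exists_rep (inc f)
        have hfi : inc f = s(a, b) := hab.symm
        have h4 := reachable_of_mem hf hfi
        rw [hfi] at hfu
        simp only [Set.mem_union, Set.mem_ofPred_eq, hfi, Sym2.mem_iff, forall_eq_or_imp,
          forall_eq] at hfu ⊢
        rcases hJ.reachable_left_iff.1 (hu.trans hfu.1) with h5 | h5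
        · exact Or.inl ⟨hf, h5, h5.trans h4⟩
        · exact Or.inr ⟨hf, h5, h5.trans h4⟩
      have h4 := Set.ncard_le_ncard h3 (Set.toFinite _)
      have h5 := Set.ncard_insert_le e
        ({f | f ∈ R ∧ ∀ a ∈ inc f, (edgeGraph inc R).Reachable p a} ∪
            {f | f ∈ R ∧ ∀ a ∈ inc f, (edgeGraph inc R).Reachable q a})
      have h6 := Set.ncard_union_le {f | f ∈ R ∧ ∀ a ∈ inc f, (edgeGraph inc R).Reachable p a}
            {f | f ∈ R ∧ ∀ a ∈ inc f, (edgeGraph inc R).Reachable q a}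
      omega
    · have h1 : ∀ a, (edgeGraph inc R).Reachable u a → ∀ b,
          (edgeGraph inc R).Adj a b ↔ (edgeGraph inc (insert e R)).Adj a b := by
        refine hJ.congr_off (fun h => hu (h.mono hJ.le).symm) fun h => hu ?_
        exact hJ.adj.reachable.trans (h.mono hJ.le).symm
      rw [order_congr h1]
      refine lt_of_le_of_lt (Set.ncard_le_ncard ?_ (Set.toFinite _)) (ih hR' u)
      rintro f ⟨rfl | hf, hfu⟩
      · exact absurd (hfu p (by simp [hi])).symm hu
      · exact ⟨hf, fun a ha => (reachable_congr h1 a).1 (hfu a ha)⟩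

section Components

variable {G : Graph α β} {R : Set E(G)}

/-- Walks of the forest stay in, and hence lift to, every subgraph of it that is closed under
adjacency. -/
lemma exists_walk_underlying {K : Graph α β}
    (hclosed : ∀ e a b, a ∈ V(K) → (spanningSubgraph G R).IsLink e a b → K.IsLink e a b)
    {a b : V(G)} (p : (edgeGraph (ends G) R).Walk a b) (ha : (a : α) ∈ V(K)) :
    ∃ (hb : (b : α) ∈ V(K)) (q : K.underlying.Walk ⟨a, ha⟩ ⟨b, hb⟩), q.length = p.length := by
  induction p with
  | nil => exact ⟨ha, .nil, rfl⟩
  | @cons a c b hadj p ih =>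
    obtain ⟨hne, e, he, hi⟩ := hadj
    have h1 := hclosed _ _ _ ha (isLink_spanningSubgraph he hi)
    obtain ⟨hb, q, hq⟩ := ih h1.right_mem
    have hadj' : K.underlying.Adj ⟨a, ha⟩ ⟨c, h1.right_mem⟩ := by
      rw [Graph.underlying, SimpleGraph.fromRel_adj]
      exact ⟨fun h => hne (Subtype.ext (congrArg (fun x : V(K) => (x : α)) h)), Or.inl ⟨e, h1⟩⟩
    exact ⟨hb, .cons hadj' q, congrArg (· + 1) hq⟩

lemma reachable_of_underlying {K : Graph α β} (hK : K ≤ spanningSubgraph G R) {a b : V(K)}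
    (h : K.underlying.Reachable a b) :
    (edgeGraph (ends G) R).Reachable ⟨a, hK.vertexSet_mono a.2⟩ ⟨b, hK.vertexSet_mono b.2⟩ := by
  obtain ⟨p⟩ := h
  induction p with
  | nil => rfl
  | @cons a c b hadj p ih =>
    refine SimpleGraph.Reachable.trans ?_ ih
    rw [Graph.underlying, SimpleGraph.fromRel_adj] at hadj
    obtain ⟨e, he⟩ : ∃ e, K.IsLink e (a : α) c := by
      rcases hadj.2 with ⟨e, he⟩ | ⟨e, he⟩
      · exact ⟨e, he⟩
      · exact ⟨e, he.symm⟩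
    obtain ⟨⟨e', he', rfl⟩, h1⟩ := he.mono hK
    exact reachable_of_mem he' (ends_eq_iff.2 h1)

/-- A component of a spanning subgraph is spanned by a component of `edgeGraph`. -/
lemma exists_eq_induce {K : Graph α β} (hK : K.IsComponent (spanningSubgraph G R)) :
    ∃ u : V(G), K = (spanningSubgraph G R).induce
      ((↑) '' {a : V(G) | (edgeGraph (ends G) R).Reachable u a}) := by
  have hKle : K ≤ spanningSubgraph G R := hK.prop.1
  obtain ⟨⟨u₀, hu₀⟩⟩ := hK.prop.2.nonempty
  let u : V(G) := ⟨u₀, hKle.vertexSet_mono hu₀⟩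
  refine ⟨u, ?_⟩
  set S : Set α := (↑) '' {a : V(G) | (edgeGraph (ends G) R).Reachable u a} with hS
  have hSV : S ⊆ V(G) := by
    rintro _ ⟨a, -, rfl⟩
    exact a.2
  have hclosed : ∀ e a b, a ∈ V((spanningSubgraph G R).induce S) →
      (spanningSubgraph G R).IsLink e a b → ((spanningSubgraph G R).induce S).IsLink e a b := by
    intro e a b ha hl
    refine ⟨hl, ha, ?_⟩
    obtain ⟨a', ha', rfl⟩ := ha
    obtain ⟨⟨e', he', rfl⟩, h1⟩ := hl
    have h2 : ends G e' = s(a', ⟨b, h1.right_mem⟩) := ends_eq_iff.2 h1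
    exact ⟨⟨b, h1.right_mem⟩, SimpleGraph.Reachable.trans ha' (reachable_of_mem he' h2), rfl⟩
  have huS : (u : α) ∈ V((spanningSubgraph G R).induce S) := ⟨u, .rfl, rfl⟩
  have hconn : ((spanningSubgraph G R).induce S).IsConnected := by
    have h1 : ∀ b : V((spanningSubgraph G R).induce S),
        ((spanningSubgraph G R).induce S).underlying.Reachable ⟨u, huS⟩ b := by
      rintro ⟨_, b, ⟨p⟩, rfl⟩
      obtain ⟨_, q, -⟩ := exists_walk_underlying hclosed p huS
      exact ⟨q⟩
    exact { preconnected := fun a b => (h1 a).symm.trans (h1 b), nonempty := ⟨⟨u, huS⟩⟩ }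
  have hle : K ≤ (spanningSubgraph G R).induce S := by
    have hVS : V(K) ⊆ S := fun a ha => ⟨⟨a, hKle.vertexSet_mono ha⟩,
      reachable_of_underlying hKle (hK.prop.2.preconnected ⟨u₀, hu₀⟩ ⟨a, ha⟩), rfl⟩
    exact ⟨hVS, fun e a b hl => ⟨hl.mono hKle, hVS hl.left_mem, hVS hl.right_mem⟩⟩
  exact le_antisymm hle (hK.le_of_ge ⟨Graph.induce_le hSV, hconn⟩ hle)

/-- Size and diameter of a component of a forest. -/
lemma exists_ncard_lt_and_diameter_le [Fintype V(G)] [Finite E(G)] (hR : IsForest (ends G) R)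
    {K : Graph α β} (hK : K.IsComponent (spanningSubgraph G R)) :
    ∃ u, E(K).ncard < order (edgeGraph (ends G) R) u ∧
      K.diameter ≤ compDiam (edgeGraph (ends G) R) u := by
  obtain ⟨u, rfl⟩ := exists_eq_induce hK
  set S : Set α := (↑) '' {a : V(G) | (edgeGraph (ends G) R).Reachable u a} with hS
  have hSV : S ⊆ V(G) := by
    rintro _ ⟨a, -, rfl⟩
    exact a.2
  refine ⟨u, lt_of_le_of_lt ?_ (ncard_lt_order hR u), ?_⟩
  · rw [← Set.ncard_image_of_injective _ (Subtype.val_injective (p := fun e => e ∈ E(G)))]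
    refine Set.ncard_le_ncard ?_ (Set.toFinite _)
    rintro e ⟨a, b, ⟨⟨e', he', rfl⟩, h1⟩, ⟨a', ha', rfl⟩, ⟨b', hb', rfl⟩⟩
    refine ⟨e', ⟨he', ?_⟩, rfl⟩
    rw [ends_eq_iff.2 h1]
    simp only [Sym2.mem_iff, forall_eq_or_imp, forall_eq]
    exact ⟨ha', hb'⟩
  · have := hK.prop.2.nonempty
    obtain ⟨⟨_, a, ha, rfl⟩, ⟨_, b, hb, rfl⟩, hd⟩ := SimpleGraph.exists_dist_eq_diam
      (G := ((spanningSubgraph G R).induce S).underlying)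
    rw [Graph.diameter, ← hd]
    have hab : (edgeGraph (ends G) R).Reachable a b := SimpleGraph.Reachable.trans ha.symm hb
    obtain ⟨p, hp⟩ := hab.exists_walk_length_eq_dist
    obtain ⟨_, q, hq⟩ := exists_walk_underlying (K := (spanningSubgraph G R).induce S)
      (fun e a b ha hl => by
        refine ⟨hl, ha, ?_⟩
        obtain ⟨a', ha', rfl⟩ := ha
        obtain ⟨⟨e', he', rfl⟩, h1⟩ := hl
        have h2 : ends G e' = s(a', ⟨b, h1.right_mem⟩) := ends_eq_iff.2 h1
        exact ⟨⟨b, h1.right_mem⟩, SimpleGraph.Reachable.trans ha' (reachable_of_mem he' h2), rfl⟩)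
      p ⟨a, ha, rfl⟩
    refine (SimpleGraph.dist_le q).trans ?_
    rw [hq, hp]
    exact dist_le_compDiam ha b

end Components

section Density

variable {G : Graph α β}

/-- The bound on the maximum average degree, applied to the induced subgraphs and cleared of
denominators. -/
lemma card_edgesIn_le_of_mad_le [Fintype V(G)] [Fintype E(G)] {k d : ℕ}
    (hmad : G.mad ≤ 2 * ((k : ℝ) + (d : ℝ) / ((d : ℝ) + (k : ℝ) + 1))) (X : Finset V(G)) :
    (d + k + 1) * (edgesIn (ends G) X).card ≤ (k + 1) * (d + k) * X.card := by
  rcases X.eq_empty_or_nonempty with rfl | hX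
  · have : edgesIn (ends G) ∅ = ∅ := by
      ext e
      simp only [mem_edgesIn, Finset.notMem_empty, iff_false, not_forall]
      exact ⟨_, Sym2.out_fst_mem (ends G e), id⟩
    simp [this]
  let Y : Set α := (↑) '' (X : Set V(G))
  have hYV : Y ⊆ V(G) := by
    rintro _ ⟨a, -, rfl⟩
    exact a.2
  have hVY : (V(G.induce Y)).ncard = X.card := by
    change Y.ncard = _
    rw [Set.ncard_image_of_injective _ Subtype.val_injective, Set.ncard_coe_finset]
  have hEY : (E(G.induce Y)).ncard = (edgesIn (ends G) X).card := by
    rw [← Set.ncard_coe_finset, ← Set.ncard_image_of_injective _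
      (Subtype.val_injective (p := fun e => e ∈ E(G)))]
    congr 1
    ext e
    constructor
    · rintro ⟨a, b, h1, ⟨a', ha', rfl⟩, ⟨b', hb', rfl⟩⟩
      refine ⟨⟨e, h1.edge_mem⟩, ?_, rfl⟩
      have h2 : ends G ⟨e, h1.edge_mem⟩ = s(a', b') := ends_eq_iff.2 h1
      rw [Finset.mem_coe, mem_edgesIn, h2]
      simpa using ⟨ha', hb'⟩
    · rintro ⟨e, he, rfl⟩
      obtain ⟨⟨a, b⟩, hab⟩ := Quot.exists_rep (ends G e)
      have hi : ends G e = s(a, b) := hab.symm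
      rw [Finset.mem_coe, mem_edgesIn, hi] at he
      simp only [Sym2.mem_iff, forall_eq_or_imp, forall_eq] at he
      exact ⟨a, b, ends_eq_iff.1 hi, ⟨a, he.1, rfl⟩, ⟨b, he.2, rfl⟩⟩
  have hbdd : BddAbove {r : ℝ | ∃ H : Graph α β, H ≤ G ∧ V(H).Nonempty ∧
      r = 2 * (E(H).ncard : ℝ) / (V(H).ncard : ℝ)} := by
    refine ⟨2 * (E(G).ncard : ℝ), ?_⟩
    rintro _ ⟨H, hH, hne, rfl⟩
    have hfin : V(H).Finite := (Set.toFinite V(G)).subset hH.vertexSet_mono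
    have h1 : 1 ≤ V(H).ncard := (Set.ncard_pos hfin).2 hne
    have h2 : E(H).ncard ≤ E(G).ncard := Set.ncard_le_ncard hH.edgeSet_mono (Set.toFinite _)
    have h3 : (1 : ℝ) ≤ V(H).ncard := by exact_mod_cast h1
    have h4 : (E(H).ncard : ℝ) ≤ E(G).ncard := by exact_mod_cast h2
    refine (div_le_self (by positivity) h3).trans (by linarith)
  have hle : 2 * ((edgesIn (ends G) X).card : ℝ) / (X.card : ℝ) ≤ G.mad := by
    refine le_csSup hbdd ⟨G.induce Y, Graph.induce_le hYV, ?_, by rw [hVY, hEY]⟩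
    obtain ⟨a, ha⟩ := hX
    exact ⟨a, a, ha, rfl⟩
  have h1 := hle.trans hmad
  have hn : (0 : ℝ) < X.card := by exact_mod_cast hX.card_pos
  have hdk : (0 : ℝ) < (d : ℝ) + k + 1 := by positivity
  rw [div_le_iff₀ hn] at h1
  have h2 : ((d : ℝ) + k + 1) * ((k : ℝ) + d / ((d : ℝ) + k + 1)) = (k + 1) * (d + k) := by
    field_simp
    ring
  have h3 : ((d : ℝ) + k + 1) * (edgesIn (ends G) X).card ≤ (k + 1) * (d + k) * X.card := by
    rw [← h2]
    nlinarith
  exact_mod_cast h3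

end Density

/-- The blue arcs leaving each vertex can be given different colours from `Fin k`. -/
lemma State.exists_coloring {V E : Type*} [Finite E] {inc : E → Sym2 V} {k : ℕ}
    (s : State inc k) : ∃ c : E → Fin (k + 1), (∀ e, c e = 0 ↔ e ∈ s.red) ∧
      ∀ e ∉ s.red, ∀ f ∉ s.red, s.o.tail e = s.o.tail f → c e = c f → e = f := by
  classical
  have h1 : ∀ v, Nonempty ({e | e ∉ s.red ∧ s.o.tail e = v} ↪ Fin k) := fun v => by
    have := Fintype.ofFinite {e | e ∉ s.red ∧ s.o.tail e = v}
    refine Function.Embedding.nonempty_of_card_le ?_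
    rw [Fintype.card_fin, ← Nat.card_eq_fintype_card]
    exact s.outdeg_le v
  let φ := fun v => (h1 v).some
  refine ⟨fun e => if he : e ∈ s.red then 0 else (φ (s.o.tail e) ⟨e, he, rfl⟩).succ,
    fun e => ?_, fun e he f hf hef hc => ?_⟩
  · by_cases he : e ∈ s.red
    · simp [he]
    · simp [he, Fin.succ_ne_zero]
  · simp only [he, hf, dif_neg, not_false_iff, Fin.succ_inj] at hc
    have h2 : ∀ v (hv : s.o.tail f = v), φ v ⟨f, hf, hv⟩ = φ (s.o.tail f) ⟨f, hf, rfl⟩ := by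
      rintro v rfl
      rfl
    rw [← h2 _ hef.symm] at hc
    exact congrArg Subtype.val ((φ _).injective hc)

end PseudoforestDecomposition

open PseudoforestDecomposition in
theorem theorem1p9 {α β : Type*} (k d : ℕ) (hk : 1 ≤ k)
    (ℓ : ℤ) (hℓ : ℓ = ⌊((d : ℝ) - 1) / ((k : ℝ) + 1)⌋)
    (G : Graph α β) (hV : V(G).Finite) (hE : E(G).Finite)
    (hmad : G.mad ≤ 2 * ((k : ℝ) + (d : ℝ) / ((d : ℝ) + (k : ℝ) + 1))) :
    ∃ P : Fin (k + 1) → Graph α β,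
      G.IsDecomposition P ∧
      (∀ i, (P i).IsPseudoforest) ∧
      ∃ i, (P i).IsAcyclic ∧
        ∀ K : Graph α β, K.IsComponent (P i) →
          E(K).ncard ≤ d ∧
          (K.diameter : ℤ) ≤ 2 * ℓ + 2 ∧
          (d ≡ 1 [MOD (k + 1)] → (K.diameter : ℤ) ≤ 2 * ℓ + 1) ∧
          ∀ z : ℕ, (d : ℤ) - (z : ℤ) * ((k : ℤ) - 1) + 1 ≤ (E(K).ncard : ℤ) →
            K.diameter ≤ 2 * z := by
  classical
  have := hV.fintype
  have := hE.fintype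
  obtain ⟨s, hs⟩ := exists_state_not_bad hk (card_edgesIn_le_of_mad_le hmad)
  obtain ⟨c, hc, hcinj⟩ := s.exists_coloring
  have hred : {e | c e = 0} = s.red := Set.ext hc
  have hforest : IsForest (ends G) {e | c e = 0} := hred ▸ s.forest
  have hacyc := hforest.isAcyclic
  refine ⟨fun i => spanningSubgraph G {e | c e = i}, ⟨fun i => ⟨spanningSubgraph_le, rfl⟩,
    fun i j hij => ?_, ?_⟩, fun i => ?_, 0, hacyc, fun K hK => ?_⟩
  · rw [edgeSet_spanningSubgraph, edgeSet_spanningSubgraph,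
      Set.disjoint_image_iff Subtype.val_injective]
    exact Set.disjoint_left.2 fun e he he' => hij (he.symm.trans he')
  · ext e
    simp only [edgeSet_spanningSubgraph, Set.mem_iUnion]
    constructor
    · rintro ⟨i, e', -, rfl⟩
      exact e'.2
    · intro he
      exact ⟨c ⟨e, he⟩, ⟨e, he⟩, rfl, rfl⟩
  · by_cases hi : i = 0
    · subst hi
      intro K hK C C' hCK hC
      exact absurd hC (hacyc C (hCK.trans hK.prop.1))
    have hblue : ∀ e, c e = i → e ∉ s.red := fun e he her => hi (he ▸ (hc e).2 her)
    by_cases hα : Nonempty α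
    swap
    · intro K hK C C' hCK hC
      obtain ⟨n, v, -⟩ := hC
      exact absurd ⟨v 0⟩ hα
    let t : β → α := fun e => if he : e ∈ E(G) then (s.o.tail ⟨e, he⟩ : α) else hα.some
    let h : β → α := fun e => if he : e ∈ E(G) then (s.o.head ⟨e, he⟩ : α) else hα.some
    have ht : ∀ e : E(G), t e = s.o.tail e := fun e => dif_pos e.2
    have hh : ∀ e : E(G), h e = s.o.head e := fun e => dif_pos e.2
    refine isPseudoforest_of_injOn (t := t) (h := h) ?_ ?_
    · rw [edgeSet_spanningSubgraph]
      rintro _ ⟨e, he, rfl⟩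
      rw [ht, hh]
      exact isLink_spanningSubgraph he (s.o.inc_eq e)
    · rw [edgeSet_spanningSubgraph]
      rintro _ ⟨e, he, rfl⟩ _ ⟨f, hf, rfl⟩ hef
      rw [ht, ht] at hef
      rw [hcinj e (hblue e he) f (hblue f hf) (Subtype.ext hef) (he.trans hf.symm)]
  · obtain ⟨u, hn, hD⟩ := exists_ncard_lt_and_diameter_le hforest hK
    rw [hred] at hn hD
    have hgood : ¬ d + 2 ≤ order s.graph u + (k - 1) * ((compDiam s.graph u - 1) / 2) := hs u
    have hDn := compDiam_lt_order s.graph u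
    change E(K).ncard < order s.graph u at hn
    change K.diameter ≤ compDiam s.graph u at hD
    set n := order s.graph u
    set D := compDiam s.graph u
    set m := E(K).ncard
    set δ := K.diameter
    -- absence of badness at the largest `z` with `2 * z < D` gives it for all smaller `z`
    have key : ∀ z : ℕ, 2 * z < D → n + (k - 1) * z ≤ d + 1 := fun z hz => by
      have h1 : (k - 1) * z ≤ (k - 1) * ((D - 1) / 2) := Nat.mul_le_mul_left _ (by omega)
      omega
    obtain ⟨κ, rfl⟩ := Nat.exists_eq_add_of_le' hk
    simp only [Nat.add_sub_cancel] at key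
    have hfloor : ℓ = ((d : ℤ) - 1) / ((κ : ℤ) + 2) := by
      rw [hℓ]
      have h1 : ((d : ℝ) - 1) / (((κ + 1 : ℕ) : ℝ) + 1) =
          ((((d : ℤ) - 1 : ℤ) : ℝ)) / ((κ + 2 : ℕ) : ℝ) := by
        push_cast
        ring
      rw [h1, Int.floor_div_natCast, Int.floor_intCast]
      push_cast
      rfl
    have hκ : (0 : ℤ) < (κ : ℤ) + 2 := by positivity
    have hlt : (d : ℤ) - 1 < ((κ : ℤ) + 2) * (ℓ + 1) := by
      rw [hfloor]
      exact Int.lt_mul_ediv_self_add hκ |>.trans_eq (by ring)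
    have hnd : (n : ℤ) ≤ d + 1 := by
      have h0 : n ≤ d + 1 := by omega
      exact_mod_cast h0
    have hℓ0 : -1 ≤ ℓ := by
      by_contra! h1
      nlinarith
    refine ⟨by omega, ?_, fun hd => ?_, fun z hz => ?_⟩
    · -- `z = ℓ + 1`, which is a natural number even for `d = 0`, where `ℓ = -1`
      by_contra! h1
      obtain ⟨z, hz⟩ := Int.eq_ofNat_of_zero_le (show 0 ≤ ℓ + 1 by omega)
      have h2 := key z (by omega)
      zify at h2
      rw [hz] at hlt
      nlinarith
    · by_contra! h1
      obtain ⟨q, hq⟩ := (Nat.modEq_iff_dvd.1 hd.symm)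
      push_cast at hq
      have hdq : (d : ℤ) - 1 = ((κ : ℤ) + 2) * q := by rw [hq]; ring
      have hq0 : 0 ≤ q := by
        by_contra! h2
        nlinarith
      have hℓq : ℓ = q := by rw [hfloor, hdq, Int.mul_ediv_cancel_left _ hκ.ne']
      obtain ⟨z, rfl⟩ := Int.eq_ofNat_of_zero_le hq0
      have h2 := key z (by omega)
      zify at h2
      nlinarith
    · by_contra! h1
      have h2 := key z (by omega)
      zify at h2 hn
      push_cast at hz
      nlinarith
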